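/- Let $W$ be a finite Coxeter group with simple generators $s_1,\dots,s_n$ and length function $\ell$, let $V=\mathbb R^n$ be its geometric (reflection) representation, and let $d_1,\dots,d_n$ be the degrees of $W$, that is, the degrees of $n$ algebraically independent homogeneous polynomials on $V$ that generate the algebra of $W$-invariant polynomials. For $q>0$ let $\pi$ be the probability distribution $$\pi(w)=\frac{q^{\ell(w)}}{P_W(q)},\qquad P_W(q)=\sum_{w\in W}q^{\ell(w)},$$ on $W$, and let $Z(w)=\ell(w)$. Then $Z$ is a sum $Z=Z_1+\dots+Z_n$ of random variables $Z_i\colon W\to\{0,1,2,\dots\}$ that are independent under $\pi$ and have moment generating functions $$E_\pi\big(e^{tZ_i}\big)=\frac{1+e^tq+\dots+(e^tq)^{d_i-1}}{1+q+\dots+q^{d_i-1}}\qquad(t\in\mathbb R),$$ which equals $\frac{1-(e^tq)^{d_i}}{1-e^tq}\cdot\frac{1-q}{1-q^{d_i}}$ when $q\ne1$ and $e^tq\neq 1$. If moreover $q\neq1$, then $$E_\pi(Z)=\frac{nq}{1-q}-\sum_{i=1}^n\frac{d_iq^{d_i}}{1-q^{d_i}}\qquad\text{and}\qquad \mathrm{Var}_\pi(Z)=\frac{nq}{(1-q)^2}-\sum_{i=1}^n\frac{d_i^2q^{d_i}}{(1-q^{d_i})^2}.$$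 -/

import Mathlib

open MeasureTheory ProbabilityTheory

noncomputable section

namespace CoxeterMatrix

variable {B : Type*} [Fintype B] [DecidableEq B] (M : CoxeterMatrix B)

/-- The simple root `α_i`: the `i`-th standard basis vector of `V = B → ℝ`. -/
def simpleRoot (i : B) : B → ℝ := Pi.single i 1

/-- The functional `v ↦ 2 ⟨α_i, v⟩`, for the symmetric bilinear form with
`⟨α_i, α_j⟩ = -cos (π / m(i, j))`. (Mathlib writes `M i j = 0` for `m(i, j) = ∞`, and then
`-cos (π / 0) = -1`, which is the usual convention.) -/
def simpleCoroot (i : B) : Module.Dual ℝ (B → ℝ) :=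
  ∑ j, (2 * -Real.cos (Real.pi / (M i j : ℝ))) • LinearMap.proj j

theorem simpleCoroot_simpleRoot (i j : B) :
    M.simpleCoroot i (simpleRoot j) = 2 * -Real.cos (Real.pi / (M i j : ℝ)) := by
  simp [simpleCoroot, simpleRoot, Pi.single_apply]

theorem simpleCoroot_simpleRoot_self (i : B) : M.simpleCoroot i (simpleRoot i) = 2 := by
  simp [simpleCoroot_simpleRoot]

/-- The simple reflection `v ↦ v - 2 ⟨α_i, v⟩ α_i` of `V`. -/
def simpleReflection (i : B) : (B → ℝ) ≃ₗ[ℝ] (B → ℝ) :=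
  Module.reflection (M.simpleCoroot_simpleRoot_self i)

theorem isLiftable_simpleReflection : M.IsLiftable M.simpleReflection := by
  intro i j
  by_cases hij : i = j
  · subst hij
    rw [M.diagonal, pow_one]
    ext1 v
    exact Module.involutive_reflection (M.simpleCoroot_simpleRoot_self i) v
  have hne1 : M i j ≠ 1 := M.off_diagonal i j hij
  obtain ⟨m, hm⟩ : ∃ m, m = M i j := ⟨_, rfl⟩
  have hg : M.simpleCoroot i (simpleRoot j) = 2 * -Real.cos (Real.pi / m) := by
    rw [simpleCoroot_simpleRoot, hm]
  have hf : M.simpleCoroot j (simpleRoot i) = 2 * -Real.cos (Real.pi / m) := by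
    rw [simpleCoroot_simpleRoot, hm, M.symmetric]
  rw [← hm] at hne1 ⊢
  ext1 z
  rw [simpleReflection, simpleReflection,
    Module.reflection_mul_reflection_pow_apply _ _ m z
      (2 * Real.cos (2 * (Real.pi / m))) (by rw [hf, hg, Real.cos_two_mul]; ring)]
  have key := fun k : ℤ => Polynomial.Chebyshev.S_two_mul_real_cos (2 * (Real.pi / m)) k
  rcases Nat.lt_or_ge m 3 with h3 | h3
  · interval_cases m
    · norm_num [Polynomial.Chebyshev.S_neg_two]
    · exact absurd rfl hne1
    · have h2 : 2 * (Real.pi / 2) = Real.pi := by ring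
      simp only [Nat.cast_ofNat, h2, Real.cos_pi, hf, hg]
      norm_num [Polynomial.Chebyshev.S_neg_one]
      module
  have hsin : Real.sin (2 * (Real.pi / m)) ≠ 0 := by
    refine (Real.sin_pos_of_pos_of_lt_pi (by positivity) ?_).ne'
    have : (3 : ℝ) ≤ m := by exact_mod_cast h3
    rw [mul_div_assoc', div_lt_iff₀ (by linarith)]
    nlinarith [Real.pi_pos]
  have hm0 : (m : ℝ) ≠ 0 := by positivity
  rcases Nat.even_or_odd' m with ⟨k, hk | hk⟩
  · have e1 : ((m : ℤ) - 2) / 2 = k - 1 := by omega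
    have e2 : ((m : ℤ) - 1) / 2 = k - 1 := by omega
    have h0 : (Polynomial.Chebyshev.S ℝ ((k : ℤ) - 1)).eval
        (2 * Real.cos (2 * (Real.pi / m))) = 0 := by
      have h := key (k - 1)
      have e : (((k : ℤ) - 1 : ℤ) + 1 : ℝ) * (2 * (Real.pi / m)) = Real.pi := by
        push_cast
        have : (m : ℝ) = 2 * k := by exact_mod_cast hk
        field_simp
        rw [this]
        ring
      rw [e, Real.sin_pi] at h
      exact (mul_eq_zero.mp h).resolve_right hsin
    rw [e1, e2, h0]
    simp
  · have e1 : ((m : ℤ) - 2) / 2 = k - 1 := by omega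
    have e2 : ((m : ℤ) - 1) / 2 = k := by omega
    have e3 : ((m : ℤ) - 3) / 2 = k - 1 := by omega
    have e4 : (m : ℤ) / 2 = k := by omega
    have h0 : (Polynomial.Chebyshev.S ℝ (k : ℤ)).eval (2 * Real.cos (2 * (Real.pi / m))) +
        (Polynomial.Chebyshev.S ℝ ((k : ℤ) - 1)).eval (2 * Real.cos (2 * (Real.pi / m))) = 0 := by
      have h := key (k - 1)
      have h' := key k
      have hm' : (m : ℝ) = 2 * k + 1 := by exact_mod_cast hk
      have e : (((k : ℤ) - 1 : ℤ) + 1 : ℝ) * (2 * (Real.pi / m)) = Real.pi - Real.pi / m := by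
        push_cast
        field_simp
        rw [hm']
        ring
      have e' : (((k : ℤ) : ℝ) + 1) * (2 * (Real.pi / m)) = Real.pi / m + Real.pi := by
        push_cast
        field_simp
        rw [hm']
        ring
      rw [e, Real.sin_pi_sub] at h
      rw [e', Real.sin_add_pi] at h'
      refine (mul_eq_zero.mp (?_ : _ * Real.sin (2 * (Real.pi / m)) = 0)).resolve_right hsin
      rw [add_mul, h, h']
      ring
    rw [e1, e2, e3, e4, h0]
    simp

end CoxeterMatrix

namespace CoxeterSystem

variable {B : Type*} [Fintype B] [DecidableEq B] {M : CoxeterMatrix B}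
  {W : Type*} [Group W] (cs : CoxeterSystem M W)

/-- The geometric (reflection) representation of a Coxeter group on `V = B → ℝ`: the generator
`s_i` acts as the simple reflection `v ↦ v - 2 ⟨α_i, v⟩ α_i`. -/
def geometricRep : W →* ((B → ℝ) ≃ₗ[ℝ] (B → ℝ)) :=
  cs.lift ⟨M.simpleReflection, M.isLiftable_simpleReflection⟩

/-- The algebra of polynomial functions on `V` that are invariant under `W`. -/
def invariants : Subalgebra ℝ (MvPolynomial B ℝ) where
  carrier := {f | ∀ (w : W) (v : B → ℝ),
    MvPolynomial.eval (cs.geometricRep w v) f = MvPolynomial.eval v f}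
  mul_mem' hf hg w v := by rw [map_mul, map_mul, hf w v, hg w v]
  add_mem' hf hg w v := by rw [map_add, map_add, hf w v, hg w v]
  algebraMap_mem' r w v := by simp [MvPolynomial.algebraMap_eq]

/-- `d_1, …, d_n` (where `n` is the number of simple generators) are the degrees of `W`: the degrees
of a system of basic invariants, that is, of `n` algebraically independent homogeneous polynomials
that generate the algebra of invariants of `W`. -/
def IsDegrees (d : Fin (Fintype.card B) → ℕ) : Prop :=
  ∃ f : Fin (Fintype.card B) → MvPolynomial B ℝ,
    (∀ i, (f i).IsHomogeneous (d i)) ∧ AlgebraicIndependent ℝ f ∧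
      Algebra.adjoin ℝ (Set.range f) = cs.invariants

end CoxeterSystem

namespace CoxeterSystem

variable {B : Type*} {M : CoxeterMatrix B} {W : Type*} [Group W] [Fintype W]
  (cs : CoxeterSystem M W)

/-- The Poincaré polynomial `P_W(q) = ∑_w q ^ ℓ(w)`. -/
def poincare (q : ℝ) : ℝ := ∑ w : W, q ^ cs.length w

/-- The measure on `W` that gives `w` the mass `q ^ ℓ(w) / P_W(q)`. -/
def mallows [MeasurableSpace W] (q : ℝ) : Measure W :=
  ∑ w : W, ENNReal.ofReal (q ^ cs.length w / cs.poincare q) • Measure.dirac w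

end CoxeterSystem

end

/-!
The divided differences `∂_w` attached to the elements of `W` are linear over the invariant
polynomials, lower degrees by `ℓ(w)` and compose like the elements of `W`, except that `∂_v ∂_w = 0`
whenever `ℓ(v w) < ℓ(v) + ℓ(w)`. Applying them to a polynomial of top degree on which `∂_{w₀}` does
not vanish gives a family dual to the `∂_w`, and such a family is a homogeneous basis, with degrees
`ℓ(w)`, of the polynomials over the invariants. Comparison with the monomial basis in the
Hilbert series gives `∑_w X ^ ℓ(w) = ∏ i, (1 + X + ⋯ + X ^ (d i - 1))`, hence a bijection
`W ≃ ∏ i, {0, …, d i - 1}` that turns the length into the sum of the coordinates. Under it the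
Mallows measure becomes a product of truncated geometric distributions.
-/

namespace CoxeterLength

open CoxeterMatrix CoxeterSystem

noncomputable section

/-! ### The geometric representation -/

section SimpleRoots

variable {B : Type*} [DecidableEq B]

theorem simpleRoot_nonneg (i : B) : 0 ≤ (simpleRoot i : B → ℝ) :=
  Pi.single_nonneg.2 zero_le_one

theorem simpleRoot_ne_zero (i : B) : (simpleRoot i : B → ℝ) ≠ 0 := by
  simp [simpleRoot]

theorem sum_smul_simpleRoot [Fintype B] (v : B → ℝ) : ∑ i, v i • simpleRoot i = v := by
  ext j
  simp [simpleRoot, Pi.single_apply]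

variable [Fintype B] (M : CoxeterMatrix B)

theorem simpleReflection_apply (i : B) (v : B → ℝ) :
    M.simpleReflection i v = v - M.simpleCoroot i v • simpleRoot i := rfl

theorem simpleReflection_simpleRoot (i j : B) :
    M.simpleReflection i (simpleRoot j) =
      simpleRoot j + (2 * Real.cos (Real.pi / (M i j : ℝ))) • simpleRoot i := by
  rw [simpleReflection_apply, simpleCoroot_simpleRoot, mul_neg, neg_smul, sub_neg_eq_add]

theorem simpleReflection_simpleRoot_self (i : B) :
    M.simpleReflection i (simpleRoot i) = -simpleRoot i :=
  Module.reflection_apply_self (M.simpleCoroot_simpleRoot_self i)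

theorem simpleReflection_simpleReflection (i : B) (v : B → ℝ) :
    M.simpleReflection i (M.simpleReflection i v) = v :=
  Module.involutive_reflection (M.simpleCoroot_simpleRoot_self i) v

end SimpleRoots

section CanonicalForm

variable {B : Type*} [Fintype B] (M : CoxeterMatrix B)

/-- The symmetric bilinear form of the geometric representation, normalised so that
`canonicalForm α_i α_j = -2 cos (π / m(i, j))`; roots then have `canonicalForm β β = 2`, and the
reflection in a root `β` is `v ↦ v - canonicalForm β v • β`. -/
def canonicalForm : LinearMap.BilinForm ℝ (B → ℝ) :=
  ∑ i, (LinearMap.proj i).smulRight (M.simpleCoroot i)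

theorem canonicalForm_apply (x y : B → ℝ) :
    canonicalForm M x y = ∑ i, x i * M.simpleCoroot i y := by
  simp [canonicalForm]

theorem canonicalForm_comm (x y : B → ℝ) : canonicalForm M x y = canonicalForm M y x := by
  simp only [canonicalForm_apply, simpleCoroot, LinearMap.sum_apply, LinearMap.smul_apply,
    LinearMap.proj_apply, smul_eq_mul, Finset.mul_sum]
  rw [Finset.sum_comm]
  refine Finset.sum_congr rfl fun i _ => Finset.sum_congr rfl fun j _ => ?_
  rw [M.symmetric]
  ring

variable [DecidableEq B]

theorem canonicalForm_simpleRoot_left (i : B) (y : B → ℝ) :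
    canonicalForm M (simpleRoot i) y = M.simpleCoroot i y := by
  simp [canonicalForm_apply, simpleRoot, Pi.single_apply]

theorem canonicalForm_simpleReflection (i : B) (x y : B → ℝ) :
    canonicalForm M (M.simpleReflection i x) (M.simpleReflection i y) = canonicalForm M x y := by
  simp only [simpleReflection_apply, map_sub, map_smul, LinearMap.sub_apply, LinearMap.smul_apply,
    canonicalForm_comm M x (simpleRoot i), canonicalForm_simpleRoot_left,
    simpleCoroot_simpleRoot_self, smul_eq_mul]
  ring

end CanonicalForm

section GeometricRep

variable {B : Type*} [Fintype B] [DecidableEq B] {M : CoxeterMatrix B}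
  {W : Type*} [Group W] (cs : CoxeterSystem M W)

theorem geometricRep_simple (i : B) : cs.geometricRep (cs.simple i) = M.simpleReflection i :=
  cs.lift_apply_simple M.isLiftable_simpleReflection i

theorem geometricRep_one_apply (v : B → ℝ) : cs.geometricRep 1 v = v := by
  rw [map_one, LinearEquiv.coe_one, id]

theorem geometricRep_mul_apply (u w : W) (v : B → ℝ) :
    cs.geometricRep (u * w) v = cs.geometricRep u (cs.geometricRep w v) := by
  rw [map_mul, LinearEquiv.mul_apply]

theorem geometricRep_inv_apply_apply (w : W) (v : B → ℝ) :
    cs.geometricRep w⁻¹ (cs.geometricRep w v) = v := by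
  rw [← geometricRep_mul_apply, inv_mul_cancel, geometricRep_one_apply]

theorem geometricRep_apply_inv_apply (w : W) (v : B → ℝ) :
    cs.geometricRep w (cs.geometricRep w⁻¹ v) = v := by
  rw [← geometricRep_mul_apply, mul_inv_cancel, geometricRep_one_apply]

theorem geometricRep_ne_zero (w : W) {v : B → ℝ} (hv : v ≠ 0) : cs.geometricRep w v ≠ 0 :=
  (LinearEquiv.map_ne_zero_iff _).2 hv

theorem canonicalForm_geometricRep (w : W) (x y : B → ℝ) :
    canonicalForm M (cs.geometricRep w x) (cs.geometricRep w y) = canonicalForm M x y := by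
  induction w using cs.simple_induction_left with
  | one => rw [geometricRep_one_apply, geometricRep_one_apply]
  | mul_simple_left w i ih =>
    rw [geometricRep_mul_apply, geometricRep_mul_apply, geometricRep_simple,
      canonicalForm_simpleReflection, ih]

end GeometricRep

/-! ### Descents and the signs of roots -/

section AlternatingFactorization

variable {B : Type*} {M : CoxeterMatrix B} {W : Type*} [Group W] (cs : CoxeterSystem M W)

theorem length_mul_wordProd_le (w : W) (ω : List B) :
    cs.length (w * cs.wordProd ω) ≤ cs.length w + ω.length :=
  (cs.length_mul_le _ _).trans (Nat.add_le_add_left (cs.length_wordProd_le ω) _)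

theorem isRightDescent_mul_wordProd_braidWord {v : W} {s t : B} (hM : M s t ≠ 0)
    (hl : cs.length (v * cs.wordProd (braidWord M s t)) = cs.length v + M s t) :
    cs.IsRightDescent (v * cs.wordProd (braidWord M s t)) s := by
  obtain ⟨k, hk⟩ := Nat.exists_eq_succ_of_ne_zero hM
  have hmul : v * cs.wordProd (braidWord M s t) * cs.simple s =
      v * cs.wordProd (alternatingWord s t k) := by
    rw [wordProd_braidWord_eq, braidWord, M.symmetric, hk, alternatingWord_succ, wordProd_concat,
      mul_assoc, cs.simple_mul_simple_cancel_right]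
  have hle := length_mul_wordProd_le cs v (alternatingWord s t k)
  rw [length_alternatingWord] at hle
  rw [IsRightDescent, hmul, hl]
  lia

/-- Letters are moved from `v` into the alternating word for as long as the length allows; the
braid relation prevents the word from reaching length `M s t`. -/
theorem exists_maximal_alternatingWord_factorization {w v : W} {s t : B} {j : ℕ}
    (hs : ¬cs.IsRightDescent w s) (hw : w = v * cs.wordProd (alternatingWord s t j))
    (hl : cs.length w = cs.length v + j) (hj : M s t = 0 ∨ j < M s t) :
    ∃ (u : W) (k : ℕ), w = u * cs.wordProd (alternatingWord s t k) ∧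
      cs.length w = cs.length u + k ∧ j ≤ k ∧ (M s t = 0 ∨ k < M s t) ∧
      ¬cs.IsRightDescent u (if Even k then t else s) := by
  induction hn : cs.length v generalizing v j with
  | zero =>
    refine ⟨v, j, hw, hl, le_rfl, hj, fun h => ?_⟩
    rw [IsRightDescent, hn] at h
    exact Nat.not_lt_zero _ h
  | succ n ih =>
    by_cases hd : cs.IsRightDescent v (if Even j then t else s)
    swap
    · exact ⟨v, j, hw, hl, le_rfl, hj, hd⟩
    rw [isRightDescent_iff] at hd
    have hw' : w = v * cs.simple (if Even j then t else s) *
        cs.wordProd (alternatingWord s t (j + 1)) := by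
      rw [alternatingWord_succ', wordProd_cons, ← mul_assoc, cs.simple_mul_simple_cancel_right, hw]
    have hne : M s t ≠ 0 → j + 1 ≠ M s t := by
      rintro hM hjM
      rw [hjM] at hw'
      subst hw'
      exact hs (isRightDescent_mul_wordProd_braidWord cs hM (by rw [braidWord]; lia))
    obtain ⟨u, k, huk, hlk, hjk, h⟩ := ih hw' (by lia) (by lia) (by lia)
    exact ⟨u, k, huk, hlk, by lia, h⟩

theorem exists_alternatingWord_factorization {w : W} {s t : B}
    (hs : ¬cs.IsRightDescent w s) (ht : cs.IsRightDescent w t) :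
    ∃ (v : W) (j : ℕ), w = v * cs.wordProd (alternatingWord s t j) ∧ cs.length v < cs.length w ∧
      (M s t = 0 ∨ j < M s t) ∧ ¬cs.IsRightDescent v s ∧ ¬cs.IsRightDescent v t := by
  have hst : s ≠ t := by
    rintro rfl
    exact hs ht
  have hM : M s t ≠ 1 := M.off_diagonal s t hst
  obtain ⟨v, k, hw, hl, hk, hkM, hnext⟩ :=
    exists_maximal_alternatingWord_factorization cs (v := w * cs.simple t) (t := t) (j := 1) hs
      (by simp [alternatingWord]) (cs.isRightDescent_iff.1 ht).symm (by lia)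
  obtain ⟨j, rfl⟩ := Nat.exists_eq_add_of_le' hk
  have hfirst : ¬cs.IsRightDescent v (if Even j then t else s) := by
    intro hd
    have hle := length_mul_wordProd_le cs (v * cs.simple (if Even j then t else s))
      (alternatingWord s t j)
    rw [mul_assoc, ← wordProd_cons, ← alternatingWord_succ', ← hw, length_alternatingWord] at hle
    rw [IsRightDescent] at hd
    lia
  refine ⟨v, j + 1, hw, by lia, hkM, ?_⟩
  by_cases hj : Even j
  · rw [if_neg (by simpa [Nat.even_add_one] using hj)] at hnext
    exact ⟨hnext, by rwa [if_pos hj] at hfirst⟩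
  · rw [if_pos (by simpa [Nat.even_add_one] using hj)] at hnext
    exact ⟨by rwa [if_neg hj] at hfirst, hnext⟩

end AlternatingFactorization

section Chebyshev

open Polynomial.Chebyshev

theorem chebyshev_S_eval_two_cos_pi_div_nonneg {m : ℕ} {k : ℤ} (hm : m ≠ 1) (hk : -1 ≤ k)
    (hkm : m = 0 ∨ k + 1 ≤ m) : 0 ≤ (S ℝ k).eval (2 * Real.cos (Real.pi / (m : ℝ))) := by
  have hk0 : (0 : ℝ) ≤ k + 1 := by exact_mod_cast (by lia : 0 ≤ k + 1)
  rcases Nat.eq_zero_or_pos m with rfl | hm0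
  · simpa using hk0
  have hm2 : (2 : ℝ) ≤ m := by exact_mod_cast (by lia : 2 ≤ m)
  have hsin : 0 < Real.sin (Real.pi / m) := by
    refine Real.sin_pos_of_pos_of_lt_pi (by positivity) ?_
    exact div_lt_self Real.pi_pos (by linarith)
  refine nonneg_of_mul_nonneg_left ?_ hsin
  rw [S_two_mul_real_cos]
  have hkm' : (k : ℝ) + 1 ≤ m := by exact_mod_cast hkm.resolve_left hm0.ne'
  refine Real.sin_nonneg_of_nonneg_of_le_pi (by positivity) ?_
  rw [mul_div_assoc', div_le_iff₀ (by linarith), mul_comm]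
  exact mul_le_mul_of_nonneg_left hkm' Real.pi_pos.le

variable {B : Type*} [Fintype B] [DecidableEq B] {M : CoxeterMatrix B}
  {W : Type*} [Group W] (cs : CoxeterSystem M W)

theorem geometricRep_alternatingWord_simpleRoot (s t : B) (j : ℕ) :
    cs.geometricRep (cs.wordProd (alternatingWord s t j)) (simpleRoot s) =
      (S ℝ j).eval (2 * Real.cos (Real.pi / (M s t : ℝ))) •
          simpleRoot (if Even j then s else t) +
        (S ℝ (j - 1)).eval (2 * Real.cos (Real.pi / (M s t : ℝ))) •
          simpleRoot (if Even j then t else s) := by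
  induction j with
  | zero => simp [alternatingWord]
  | succ j ih =>
    rw [alternatingWord_succ', wordProd_cons, geometricRep_mul_apply, ih, geometricRep_simple,
      Nat.cast_succ, S_add_one, add_sub_cancel_right, map_add, map_smul, map_smul,
      simpleReflection_simpleRoot_self, simpleReflection_simpleRoot]
    by_cases hj : Even j
    · simp only [hj, Nat.even_add_one, not_true, if_true, if_false, M.symmetric t s,
        Polynomial.eval_sub, Polynomial.eval_mul, Polynomial.eval_X]
      module
    · simp only [hj, Nat.even_add_one, not_false_eq_true, if_true, if_false,
        Polynomial.eval_sub, Polynomial.eval_mul, Polynomial.eval_X]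
      module

end Chebyshev

section SignOfRoots

variable {B : Type*} [Fintype B] [DecidableEq B] {M : CoxeterMatrix B}
  {W : Type*} [Group W] (cs : CoxeterSystem M W)

theorem geometricRep_simpleRoot_nonneg {w : W} {s : B} (hs : ¬cs.IsRightDescent w s) :
    0 ≤ cs.geometricRep w (simpleRoot s) := by
  induction hn : cs.length w using Nat.strong_induction_on generalizing w s with
  | _ n ih =>
    subst hn
    by_cases hw1 : w = 1
    · rw [hw1, geometricRep_one_apply]
      exact simpleRoot_nonneg s
    obtain ⟨t, ht⟩ := cs.exists_rightDescent_of_ne_one hw1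
    obtain ⟨v, j, hw, hlen, hj, hvs, hvt⟩ := exists_alternatingWord_factorization cs hs ht
    have hst : s ≠ t := by
      rintro rfl
      exact hs ht
    have hM : M s t ≠ 1 := M.off_diagonal s t hst
    have ih_ite (p : Prop) [Decidable p] (a b : B) (ha : ¬cs.IsRightDescent v a)
        (hb : ¬cs.IsRightDescent v b) : 0 ≤ cs.geometricRep v (simpleRoot (if p then a else b)) :=
      ih _ hlen (by split_ifs <;> assumption) rfl
    rw [hw, geometricRep_mul_apply, geometricRep_alternatingWord_simpleRoot, map_add, map_smul,
      map_smul]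
    exact add_nonneg
      (smul_nonneg (chebyshev_S_eval_two_cos_pi_div_nonneg hM (by lia) (by lia))
        (ih_ite _ s t hvs hvt))
      (smul_nonneg (chebyshev_S_eval_two_cos_pi_div_nonneg hM (by lia) (by lia))
        (ih_ite _ t s hvt hvs))

theorem geometricRep_simpleRoot_nonpos {w : W} {s : B} (hs : cs.IsRightDescent w s) :
    cs.geometricRep w (simpleRoot s) ≤ 0 := by
  have h := geometricRep_simpleRoot_nonneg cs (cs.isRightDescent_iff_not_isRightDescent_mul.1 hs)
  rwa [geometricRep_mul_apply, geometricRep_simple, simpleReflection_simpleRoot_self, map_neg,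
    Left.nonneg_neg_iff] at h

theorem isRightDescent_iff_geometricRep_nonpos {w : W} {s : B} :
    cs.IsRightDescent w s ↔ cs.geometricRep w (simpleRoot s) ≤ 0 := by
  refine ⟨geometricRep_simpleRoot_nonpos cs, fun h => ?_⟩
  by_contra hs
  exact geometricRep_ne_zero cs w (simpleRoot_ne_zero s)
    (le_antisymm h (geometricRep_simpleRoot_nonneg cs hs))

theorem geometricRep_injective : Function.Injective cs.geometricRep := by
  rw [injective_iff_map_eq_one]
  intro w hw
  by_contra h1
  obtain ⟨t, ht⟩ := cs.exists_rightDescent_of_ne_one h1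
  have h := geometricRep_simpleRoot_nonpos cs ht
  rw [hw] at h
  exact simpleRoot_ne_zero t (le_antisymm h (simpleRoot_nonneg t))

end SignOfRoots

/-! ### Inversion roots -/

section Roots

variable {B : Type*} [Fintype B] [DecidableEq B] {M : CoxeterMatrix B}
  {W : Type*} [Group W] (cs : CoxeterSystem M W)

/-- The roots of the Coxeter system: the images of the simple roots under the group. -/
def IsRoot (β : B → ℝ) : Prop := ∃ (w : W) (i : B), cs.geometricRep w (simpleRoot i) = β

variable {cs}

theorem isRoot_simpleRoot (i : B) : IsRoot cs (simpleRoot i) :=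
  ⟨1, i, geometricRep_one_apply cs _⟩

namespace IsRoot

variable {β : B → ℝ}

theorem map (h : IsRoot cs β) (w : W) : IsRoot cs (cs.geometricRep w β) := by
  obtain ⟨u, i, rfl⟩ := h
  exact ⟨w * u, i, geometricRep_mul_apply cs _ _ _⟩

theorem simpleReflection (h : IsRoot cs β) (i : B) : IsRoot cs (M.simpleReflection i β) := by
  simpa only [geometricRep_simple] using h.map (cs.simple i)

theorem ne_zero (h : IsRoot cs β) : β ≠ 0 := by
  obtain ⟨u, i, rfl⟩ := h
  exact geometricRep_ne_zero cs u (simpleRoot_ne_zero i)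

theorem nonneg_or_nonpos (h : IsRoot cs β) : 0 ≤ β ∨ β ≤ 0 := by
  obtain ⟨u, i, rfl⟩ := h
  by_cases hd : cs.IsRightDescent u i
  · exact Or.inr (geometricRep_simpleRoot_nonpos cs hd)
  · exact Or.inl (geometricRep_simpleRoot_nonneg cs hd)

theorem canonicalForm_self (h : IsRoot cs β) : canonicalForm M β β = 2 := by
  obtain ⟨u, i, rfl⟩ := h
  rw [canonicalForm_geometricRep, canonicalForm_simpleRoot_left, simpleCoroot_simpleRoot_self]

theorem eq_one_of_smul_simpleRoot {i : B} {c : ℝ} (h : IsRoot cs (c • simpleRoot i))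
    (hc : 0 ≤ c) : c = 1 := by
  have hsq := h.canonicalForm_self
  rw [map_smul, map_smul, LinearMap.smul_apply, canonicalForm_simpleRoot_left,
    simpleCoroot_simpleRoot_self, smul_eq_mul, smul_eq_mul] at hsq
  nlinarith

/-- A simple reflection changes only one coordinate, so a positive root that it makes negative has
no other coordinates. -/
theorem eq_simpleRoot (h : IsRoot cs β) (hβ : 0 ≤ β) {i : B}
    (hi : M.simpleReflection i β ≤ 0) : β = simpleRoot i := by
  have hj (j : B) (hji : j ≠ i) : β j = 0 := by
    refine le_antisymm ?_ (hβ j)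
    simpa [simpleReflection_apply, simpleRoot, Pi.single_apply, hji] using hi j
  have hβi : β = β i • simpleRoot i := by
    ext j
    by_cases hji : j = i
    · simp [simpleRoot, hji]
    · simp [simpleRoot, hji, hj j hji]
  rw [hβi] at h
  rw [hβi, h.eq_one_of_smul_simpleRoot (hβ i), one_smul]

theorem simpleReflection_nonpos_iff (h : IsRoot cs β) {i : B} :
    M.simpleReflection i β ≤ 0 ↔ β = simpleRoot i ∨ β ≤ 0 ∧ β ≠ -simpleRoot i := by
  constructor
  · intro hi
    rcases h.nonneg_or_nonpos with hβ | hβ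
    · exact Or.inl (h.eq_simpleRoot hβ hi)
    · refine Or.inr ⟨hβ, ?_⟩
      rintro rfl
      rw [map_neg, simpleReflection_simpleRoot_self, neg_neg] at hi
      exact simpleRoot_ne_zero i (le_antisymm hi (simpleRoot_nonneg i))
  · rintro (rfl | ⟨hβ, hne⟩)
    · rw [simpleReflection_simpleRoot_self]
      exact neg_nonpos.2 (simpleRoot_nonneg i)
    · refine (h.simpleReflection i).nonneg_or_nonpos.resolve_left fun hi => hne ?_
      have := (h.simpleReflection i).eq_simpleRoot hi (i := i)
        (by rwa [simpleReflection_simpleReflection])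
      rw [← simpleReflection_simpleRoot_self, ← this, simpleReflection_simpleReflection]

end IsRoot

variable (cs)

/-- The positive roots that `w` makes negative; there are `ℓ(w)` of them. -/
def IsInversionRoot (w : W) (β : B → ℝ) : Prop :=
  IsRoot cs β ∧ 0 ≤ β ∧ cs.geometricRep w β ≤ 0

theorem not_isInversionRoot_one (β : B → ℝ) : ¬IsInversionRoot cs 1 β := by
  rintro ⟨h, h0, h1⟩
  rw [geometricRep_one_apply] at h1
  exact h.ne_zero (le_antisymm h1 h0)

theorem isInversionRoot_simple_mul_iff {w : W} {i : B}
    (hi : 0 ≤ cs.geometricRep w⁻¹ (simpleRoot i)) {β : B → ℝ} :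
    IsInversionRoot cs (cs.simple i * w) β ↔
      β = cs.geometricRep w⁻¹ (simpleRoot i) ∨ IsInversionRoot cs w β := by
  have hinv (γ : B → ℝ) : cs.geometricRep w β = γ ↔ β = cs.geometricRep w⁻¹ γ :=
    ⟨fun h => by rw [← h, geometricRep_inv_apply_apply],
      fun h => by rw [h, geometricRep_apply_inv_apply]⟩
  rw [IsInversionRoot, IsInversionRoot, geometricRep_mul_apply, geometricRep_simple]
  constructor
  · rintro ⟨h, h0, h1⟩
    rw [(h.map w).simpleReflection_nonpos_iff, hinv] at h1
    exact h1.imp_right fun h2 => ⟨h, h0, h2.1⟩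
  · rintro (rfl | ⟨h, h0, h1⟩)
    · refine ⟨(isRoot_simpleRoot i).map _, hi, ?_⟩
      rw [geometricRep_apply_inv_apply, simpleReflection_simpleRoot_self]
      exact neg_nonpos.2 (simpleRoot_nonneg i)
    · refine ⟨h, h0, (h.map w).simpleReflection_nonpos_iff.2 (Or.inr ⟨h1, fun h2 => ?_⟩)⟩
      rw [hinv, map_neg] at h2
      exact h.ne_zero (le_antisymm (h2 ▸ neg_nonpos.2 hi) h0)

theorem geometricRep_inv_simpleRoot_nonneg_of_isReduced_cons {i : B} {ω : List B}
    (h : cs.IsReduced (i :: ω)) : 0 ≤ cs.geometricRep (cs.wordProd ω)⁻¹ (simpleRoot i) := by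
  have hω : cs.IsReduced ω := by simpa using h.drop 1
  refine geometricRep_simpleRoot_nonneg cs ?_
  rw [isRightDescent_inv_iff, IsLeftDescent, ← wordProd_cons, h.eq, hω.eq, List.length_cons]
  lia

end Roots

section Erasures

variable {B : Type*} [Fintype B] [DecidableEq B] {M : CoxeterMatrix B}
  {W : Type*} [Group W] (cs : CoxeterSystem M W)

/-- The words obtained from `ω` by erasing one letter, each paired with the root `β` for which the
product of the shorter word is the product of `ω` times the reflection in `β`. -/
def erasures : List B → List ((B → ℝ) × List B)
  | [] => []
  | i :: ω => (cs.geometricRep (cs.wordProd ω)⁻¹ (simpleRoot i), ω) ::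
      (erasures ω).map (Prod.map id (List.cons i))

variable {cs}

theorem length_of_mem_erasures {ω : List B} {p : (B → ℝ) × List B} (hp : p ∈ erasures cs ω) :
    p.2.length + 1 = ω.length := by
  induction ω generalizing p with
  | nil => simp [erasures] at hp
  | cons i ω ih =>
    rw [erasures, List.mem_cons, List.mem_map] at hp
    rcases hp with rfl | ⟨p, hp, rfl⟩
    · rfl
    · simp [← ih hp]

theorem geometricRep_wordProd_of_mem_erasures {ω : List B} {p : (B → ℝ) × List B}
    (hp : p ∈ erasures cs ω) (v : B → ℝ) :
    cs.geometricRep (cs.wordProd p.2) v =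
      cs.geometricRep (cs.wordProd ω) (v - canonicalForm M p.1 v • p.1) := by
  induction ω generalizing p with
  | nil => simp [erasures] at hp
  | cons i ω ih =>
    rw [erasures, List.mem_cons, List.mem_map] at hp
    rcases hp with rfl | ⟨p, hp, rfl⟩
    · rw [wordProd_cons, geometricRep_mul_apply, map_sub, map_smul, geometricRep_apply_inv_apply,
        ← canonicalForm_geometricRep cs (cs.wordProd ω), geometricRep_apply_inv_apply,
        canonicalForm_simpleRoot_left, geometricRep_simple, ← simpleReflection_apply,
        simpleReflection_simpleReflection]
    · simp only [Prod.map_fst, Prod.map_snd, id, wordProd_cons, geometricRep_mul_apply, ih hp]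

theorem wordProd_eq_of_mem_erasures {ω ω' : List B} {p p' : (B → ℝ) × List B}
    (hp : p ∈ erasures cs ω) (hp' : p' ∈ erasures cs ω') (h : cs.wordProd ω = cs.wordProd ω')
    (hpp' : p.1 = p'.1) : cs.wordProd p.2 = cs.wordProd p'.2 := by
  refine geometricRep_injective cs (LinearEquiv.ext fun v => ?_)
  rw [geometricRep_wordProd_of_mem_erasures hp, geometricRep_wordProd_of_mem_erasures hp', h, hpp']

variable (cs) in
theorem map_fst_erasures_cons (i : B) (ω : List B) :
    (erasures cs (i :: ω)).map Prod.fst =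
      cs.geometricRep (cs.wordProd ω)⁻¹ (simpleRoot i) :: (erasures cs ω).map Prod.fst := by
  simp [erasures]

theorem mem_map_fst_erasures {ω : List B} (hω : cs.IsReduced ω) (β : B → ℝ) :
    β ∈ (erasures cs ω).map Prod.fst ↔ IsInversionRoot cs (cs.wordProd ω) β := by
  induction ω with
  | nil => simp [erasures, not_isInversionRoot_one]
  | cons i ω ih =>
    rw [map_fst_erasures_cons, List.mem_cons, ih (by simpa using hω.drop 1), wordProd_cons,
      isInversionRoot_simple_mul_iff cs
        (geometricRep_inv_simpleRoot_nonneg_of_isReduced_cons cs hω)]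

theorem nodup_map_fst_erasures {ω : List B} (hω : cs.IsReduced ω) :
    ((erasures cs ω).map Prod.fst).Nodup := by
  induction ω with
  | nil => simp [erasures]
  | cons i ω ih =>
    have hω' : cs.IsReduced ω := by simpa using hω.drop 1
    rw [map_fst_erasures_cons, List.nodup_cons, mem_map_fst_erasures hω']
    refine ⟨fun h => ?_, ih hω'⟩
    have h1 := h.2.2
    rw [geometricRep_apply_inv_apply] at h1
    exact simpleRoot_ne_zero i (le_antisymm h1 (simpleRoot_nonneg i))

theorem map_wordProd_erasures_subset {ω ω' : List B} (hω : cs.IsReduced ω)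
    (hω' : cs.IsReduced ω') (h : cs.wordProd ω = cs.wordProd ω') :
    (erasures cs ω).map (Prod.map id cs.wordProd) ⊆
      (erasures cs ω').map (Prod.map id cs.wordProd) := by
  intro a ha
  obtain ⟨p, hp, rfl⟩ := List.mem_map.1 ha
  have hβ := (mem_map_fst_erasures hω p.1).1 (List.mem_map_of_mem hp)
  rw [h, ← mem_map_fst_erasures hω'] at hβ
  obtain ⟨p', hp', hpp'⟩ := List.mem_map.1 hβ
  refine List.mem_map.2 ⟨p', hp', Prod.ext hpp' ?_⟩
  exact wordProd_eq_of_mem_erasures hp' hp h.symm hpp'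

theorem map_wordProd_erasures_perm {ω ω' : List B} (hω : cs.IsReduced ω) (hω' : cs.IsReduced ω')
    (h : cs.wordProd ω = cs.wordProd ω') :
    ((erasures cs ω).map (Prod.map id cs.wordProd)).Perm
      ((erasures cs ω').map (Prod.map id cs.wordProd)) := by
  have hnodup {ζ : List B} (hζ : cs.IsReduced ζ) :
      ((erasures cs ζ).map (Prod.map id cs.wordProd)).Nodup :=
    List.Nodup.of_map Prod.fst (by simpa [Function.comp_def] using nodup_map_fst_erasures hζ)
  refine (List.perm_ext_iff_of_nodup (hnodup hω) (hnodup hω')).2 fun a => ⟨?_, ?_⟩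
  · exact fun ha => map_wordProd_erasures_subset hω hω' h ha
  · exact fun ha => map_wordProd_erasures_subset hω' hω h.symm ha

end Erasures

/-! ### Divided differences -/

open MvPolynomial

section Homogeneous

variable {σ R : Type*} [CommSemiring R]

theorem eq_C_constantCoeff_of_isHomogeneous_zero {f : MvPolynomial σ R}
    (hf : f.IsHomogeneous 0) : f = C (constantCoeff f) := by
  rw [constantCoeff_eq]
  exact totalDegree_eq_zero_iff_eq_C.1 ((totalDegree_zero_iff_isHomogeneous σ).2 hf)

theorem mem_of_forall_X_mul_mem {n : ℕ} {f : MvPolynomial σ R} (hf : f.IsHomogeneous (n + 1))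
    (p : Submodule R (MvPolynomial σ R)) (h : ∀ j g, g.IsHomogeneous n → X j * g ∈ p) :
    f ∈ p := by
  classical
  rw [f.as_sum]
  refine p.sum_mem fun d hd => ?_
  have hdeg : n + 1 = d.degree := hf.degree_eq_sum_deg_support hd
  obtain ⟨j, hj⟩ : ∃ j, d j ≠ 0 := by
    by_contra! h0
    rw [show d = 0 from Finsupp.ext h0, map_zero] at hdeg
    exact Nat.succ_ne_zero n hdeg
  have hle : Finsupp.single j 1 ≤ d := by
    rw [Finsupp.single_le_iff]
    lia
  have hd' : Finsupp.single j 1 + (d - Finsupp.single j 1) = d := add_tsub_cancel_of_le hle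
  have hdeg' := congrArg Finsupp.degree hd'
  rw [map_add, Finsupp.degree_single] at hdeg'
  rw [← hd', monomial_single_add, pow_one]
  exact h j _ (isHomogeneous_monomial _ (by lia))

end Homogeneous

section LinearPoly

variable {B R : Type*} [Fintype B] [DecidableEq B] [CommSemiring R]

/-- A linear functional on `B → R`, as a polynomial in the coordinates. -/
def linearPoly (φ : Module.Dual R (B → R)) : MvPolynomial B R :=
  ∑ j, C (φ (Pi.single j 1)) * X j

theorem eval_linearPoly (φ : Module.Dual R (B → R)) (v : B → R) :
    eval v (linearPoly φ) = φ v := by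
  simp [linearPoly, LinearMap.pi_apply_eq_sum_univ φ v, mul_comm, ← Pi.single_apply,
    Pi.single_comm]

theorem linearPoly_proj (j : B) : linearPoly (LinearMap.proj j) = (X j : MvPolynomial B R) := by
  simp [linearPoly, Pi.single_apply]

theorem isHomogeneous_linearPoly (φ : Module.Dual R (B → R)) : (linearPoly φ).IsHomogeneous 1 :=
  IsHomogeneous.sum _ _ _ fun j _ => (isHomogeneous_X R j).C_mul _

/-- The substitution `f ↦ f ∘ φ` of a linear map into polynomials. -/
def linearSubst (φ : (B → R) →ₗ[R] (B → R)) : MvPolynomial B R →ₐ[R] MvPolynomial B R :=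
  aeval fun j => linearPoly (LinearMap.proj j ∘ₗ φ)

theorem eval_linearSubst (φ : (B → R) →ₗ[R] (B → R)) (v : B → R) (f : MvPolynomial B R) :
    eval v (linearSubst φ f) = eval (φ v) f := by
  induction f using MvPolynomial.induction_on with
  | C a => simp [linearSubst]
  | add p q hp hq => rw [map_add, map_add, map_add, hp, hq]
  | mul_X p j hp =>
    rw [map_mul, map_mul, map_mul, hp]
    simp [linearSubst, eval_linearPoly]

end LinearPoly

section PolyAct

variable {B : Type*} [Fintype B] [DecidableEq B] {M : CoxeterMatrix B}
  {W : Type*} [Group W] (cs : CoxeterSystem M W)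

/-- The action of the group on polynomial functions, `(w f)(v) = f(w⁻¹ v)`. -/
def polyAct : W →* (MvPolynomial B ℝ →ₐ[ℝ] MvPolynomial B ℝ) where
  toFun w := linearSubst (cs.geometricRep w⁻¹).toLinearMap
  map_one' := AlgHom.ext fun f => MvPolynomial.funext fun v => by
    simp [eval_linearSubst]
  map_mul' u w := AlgHom.ext fun f => MvPolynomial.funext fun v => by
    simp [eval_linearSubst, -map_inv]

theorem eval_polyAct (w : W) (v : B → ℝ) (f : MvPolynomial B ℝ) :
    eval v (polyAct cs w f) = eval (cs.geometricRep w⁻¹ v) f :=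
  eval_linearSubst _ v f

theorem polyAct_linearPoly (w : W) (φ : Module.Dual ℝ (B → ℝ)) :
    polyAct cs w (linearPoly φ) = linearPoly (φ ∘ₗ (cs.geometricRep w⁻¹).toLinearMap) :=
  MvPolynomial.funext fun v => by
    rw [eval_polyAct, eval_linearPoly, eval_linearPoly, LinearMap.comp_apply, LinearEquiv.coe_coe]

theorem mem_invariants_iff {f : MvPolynomial B ℝ} :
    f ∈ cs.invariants ↔ ∀ w, polyAct cs w f = f := by
  constructor
  · intro h w
    refine MvPolynomial.funext fun v => ?_
    rw [eval_polyAct]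
    exact h w⁻¹ v
  · intro h w v
    rw [← inv_inv w, ← eval_polyAct, h]

theorem mem_invariants_iff_simple {f : MvPolynomial B ℝ} :
    f ∈ cs.invariants ↔ ∀ i, polyAct cs (cs.simple i) f = f := by
  rw [mem_invariants_iff]
  refine ⟨fun h i => h _, fun h w => ?_⟩
  induction w using cs.simple_induction_right with
  | one => rw [map_one, AlgHom.one_apply]
  | mul_simple_right w i ih => rw [map_mul, AlgHom.mul_apply, h, ih]

end PolyAct

section Demazure

variable {B : Type*} [Fintype B] [DecidableEq B] {M : CoxeterMatrix B}

variable (M) in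
/-- A simple coroot as a polynomial; it cuts out the mirror of the simple reflection. -/
def corootPoly (i : B) : MvPolynomial B ℝ := linearPoly (M.simpleCoroot i)

theorem corootPoly_ne_zero (i : B) : corootPoly M i ≠ 0 := by
  intro h
  have h2 := congrArg (eval (simpleRoot i)) h
  rw [corootPoly, eval_linearPoly, simpleCoroot_simpleRoot_self] at h2
  norm_num at h2

variable {W : Type*} [Group W] (cs : CoxeterSystem M W)

theorem polyAct_simple_corootPoly (i : B) :
    polyAct cs (cs.simple i) (corootPoly M i) = -corootPoly M i := by
  refine MvPolynomial.funext fun v => ?_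
  simp only [corootPoly, eval_polyAct, eval_linearPoly, inv_simple, geometricRep_simple,
    simpleReflection_apply, map_sub, map_smul, simpleCoroot_simpleRoot_self, map_neg, smul_eq_mul]
  ring

theorem corootPoly_dvd_sub_polyAct_simple (i : B) (f : MvPolynomial B ℝ) :
    corootPoly M i ∣ f - polyAct cs (cs.simple i) f := by
  induction f using MvPolynomial.induction_on with
  | C a => simp [← algebraMap_eq]
  | add p q hp hq =>
    rw [map_add, add_sub_add_comm]
    exact dvd_add hp hq
  | mul_X p j hp =>
    have hX : corootPoly M i ∣ X j - polyAct cs (cs.simple i) (X j) := by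
      refine ⟨C (simpleRoot i j), MvPolynomial.funext fun v => ?_⟩
      simp [corootPoly, eval_polyAct, eval_linearPoly, geometricRep_simple, simpleReflection_apply]
    have hmul : p * X j - polyAct cs (cs.simple i) (p * X j) =
        (p - polyAct cs (cs.simple i) p) * X j +
          polyAct cs (cs.simple i) p * (X j - polyAct cs (cs.simple i) (X j)) := by
      rw [map_mul]
      ring
    rw [hmul]
    exact dvd_add (hp.mul_right _) (hX.mul_left _)

/-- The divided difference (Demazure) operator `f ↦ (f - s_i f) / α_i^∨`. -/
def demazure (i : B) : Module.End ℝ (MvPolynomial B ℝ) where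
  toFun f := (corootPoly_dvd_sub_polyAct_simple cs i f).choose
  map_add' f g := mul_left_cancel₀ (corootPoly_ne_zero (M := M) i) <| by
    rw [mul_add, ← (corootPoly_dvd_sub_polyAct_simple cs i _).choose_spec,
      ← (corootPoly_dvd_sub_polyAct_simple cs i _).choose_spec,
      ← (corootPoly_dvd_sub_polyAct_simple cs i _).choose_spec, map_add, add_sub_add_comm]
  map_smul' r f := mul_left_cancel₀ (corootPoly_ne_zero (M := M) i) <| by
    rw [RingHom.id_apply, mul_smul_comm, ← (corootPoly_dvd_sub_polyAct_simple cs i _).choose_spec,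
      ← (corootPoly_dvd_sub_polyAct_simple cs i _).choose_spec, map_smul, smul_sub]

theorem corootPoly_mul_demazure (i : B) (f : MvPolynomial B ℝ) :
    corootPoly M i * demazure cs i f = f - polyAct cs (cs.simple i) f :=
  (corootPoly_dvd_sub_polyAct_simple cs i f).choose_spec.symm

theorem demazure_eq_iff {i : B} {f g : MvPolynomial B ℝ} :
    demazure cs i f = g ↔ corootPoly M i * g = f - polyAct cs (cs.simple i) f := by
  rw [← corootPoly_mul_demazure, mul_right_inj' (corootPoly_ne_zero i), eq_comm]

theorem mem_invariants_iff_demazure {f : MvPolynomial B ℝ} :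
    f ∈ cs.invariants ↔ ∀ i, demazure cs i f = 0 := by
  rw [mem_invariants_iff_simple]
  refine forall_congr' fun i => ?_
  rw [demazure_eq_iff, mul_zero, eq_comm (a := 0), sub_eq_zero, eq_comm]

theorem demazure_C (i : B) (a : ℝ) : demazure cs i (C a) = 0 := by
  rw [demazure_eq_iff, ← algebraMap_eq, AlgHom.commutes, sub_self, mul_zero]

theorem demazure_mul (i : B) (f g : MvPolynomial B ℝ) :
    demazure cs i (f * g) =
      demazure cs i f * g + polyAct cs (cs.simple i) f * demazure cs i g := by
  rw [demazure_eq_iff, mul_add, ← mul_assoc, corootPoly_mul_demazure, mul_left_comm,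
    corootPoly_mul_demazure, map_mul]
  ring

theorem demazure_smul (i : B) (a : cs.invariants) (g : MvPolynomial B ℝ) :
    demazure cs i (a • g) = a • demazure cs i g := by
  rw [Subalgebra.smul_def, Subalgebra.smul_def, smul_eq_mul, smul_eq_mul, demazure_mul,
    (mem_invariants_iff_demazure cs).1 a.2, (mem_invariants_iff cs).1 a.2, zero_mul, zero_add]

theorem demazure_demazure (i : B) (f : MvPolynomial B ℝ) :
    demazure cs i (demazure cs i f) = 0 := by
  rw [demazure_eq_iff, mul_zero, eq_comm, sub_eq_zero]
  have h := congrArg (polyAct cs (cs.simple i)) (corootPoly_mul_demazure cs i f)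
  rw [map_mul, polyAct_simple_corootPoly, map_sub, ← AlgHom.mul_apply, ← map_mul,
    simple_mul_simple_self, map_one, AlgHom.one_apply] at h
  apply mul_left_cancel₀ (corootPoly_ne_zero (M := M) i)
  linear_combination corootPoly_mul_demazure cs i f + h

theorem demazure_linearPoly (i : B) (φ : Module.Dual ℝ (B → ℝ)) :
    demazure cs i (linearPoly φ) = C (φ (simpleRoot i)) := by
  rw [demazure_eq_iff]
  refine MvPolynomial.funext fun v => ?_
  simp [corootPoly, eval_polyAct, eval_linearPoly, geometricRep_simple, simpleReflection_apply]

theorem isHomogeneous_demazure (i : B) {n : ℕ} {f : MvPolynomial B ℝ}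
    (hf : f.IsHomogeneous (n + 1)) : (demazure cs i f).IsHomogeneous n := by
  have hX_mul (j : B) (g : MvPolynomial B ℝ) : demazure cs i (X j * g) =
      C (simpleRoot i j) * g + polyAct cs (cs.simple i) (X j) * demazure cs i g := by
    rw [demazure_mul, ← linearPoly_proj, demazure_linearPoly, LinearMap.proj_apply]
  induction n generalizing f with
  | zero =>
    refine mem_of_forall_X_mul_mem hf ((homogeneousSubmodule B ℝ 0).comap (demazure cs i))
      fun j g hg => ?_
    rw [Submodule.mem_comap, mem_homogeneousSubmodule, hX_mul,
      eq_C_constantCoeff_of_isHomogeneous_zero hg, demazure_C, mul_zero, add_zero, ← C_mul]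
    exact isHomogeneous_C _ _
  | succ n ih =>
    refine mem_of_forall_X_mul_mem hf ((homogeneousSubmodule B ℝ (n + 1)).comap (demazure cs i))
      fun j g hg => ?_
    rw [Submodule.mem_comap, mem_homogeneousSubmodule, hX_mul, ← linearPoly_proj,
      polyAct_linearPoly, add_comm n]
    rw [add_comm n] at hg
    exact (hg.C_mul _).add ((isHomogeneous_linearPoly _).mul (ih (by rwa [add_comm n])))

end Demazure

section DemazureWord

variable {B : Type*} [Fintype B] [DecidableEq B] {M : CoxeterMatrix B}
  {W : Type*} [Group W] (cs : CoxeterSystem M W)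

/-- The composite of the divided difference operators along a word, the first letter outermost. -/
def demazureWord (ω : List B) : Module.End ℝ (MvPolynomial B ℝ) := (ω.map (demazure cs)).prod

theorem demazureWord_nil : demazureWord cs [] = 1 := rfl

theorem demazureWord_cons (i : B) (ω : List B) :
    demazureWord cs (i :: ω) = demazure cs i * demazureWord cs ω := by
  rw [demazureWord, List.map_cons, List.prod_cons, demazureWord]

theorem demazureWord_append (ω η : List B) :
    demazureWord cs (ω ++ η) = demazureWord cs ω * demazureWord cs η := by
  rw [demazureWord, List.map_append, List.prod_append, demazureWord, demazureWord]

theorem demazureWord_smul (ω : List B) (a : cs.invariants) (g : MvPolynomial B ℝ) :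
    demazureWord cs ω (a • g) = a • demazureWord cs ω g := by
  induction ω with
  | nil => rfl
  | cons i ω ih =>
    rw [demazureWord_cons, Module.End.mul_apply, Module.End.mul_apply, ih, demazure_smul]

theorem isHomogeneous_demazureWord {ω : List B} {m : ℕ} {f : MvPolynomial B ℝ}
    (hf : f.IsHomogeneous (ω.length + m)) : (demazureWord cs ω f).IsHomogeneous m := by
  induction ω generalizing m with
  | nil => simpa [demazureWord_nil] using hf
  | cons i ω ih =>
    rw [demazureWord_cons, Module.End.mul_apply]
    refine isHomogeneous_demazure cs i (ih ?_)
    rwa [List.length_cons, add_right_comm, add_assoc] at hf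

theorem demazureWord_eq_zero {ω : List B} {n : ℕ} {f : MvPolynomial B ℝ}
    (hf : f.IsHomogeneous n) (hn : n < ω.length) : demazureWord cs ω f = 0 := by
  induction ω with
  | nil => exact absurd hn (Nat.not_lt_zero n)
  | cons i ω ih =>
    rw [demazureWord_cons, Module.End.mul_apply]
    rcases Nat.lt_or_ge n ω.length with h | h
    · rw [ih h, map_zero]
    · rw [List.length_cons] at hn
      obtain rfl : n = ω.length + 0 := by lia
      rw [eq_C_constantCoeff_of_isHomogeneous_zero (isHomogeneous_demazureWord cs hf), demazure_C]

theorem demazureWord_linearPoly_mul (φ : Module.Dual ℝ (B → ℝ)) (ω : List B)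
    (f : MvPolynomial B ℝ) :
    demazureWord cs ω (linearPoly φ * f) =
      polyAct cs (cs.wordProd ω) (linearPoly φ) * demazureWord cs ω f +
        ((erasures cs ω).map fun p => φ p.1 • demazureWord cs p.2 f).sum := by
  induction ω with
  | nil => simp [erasures, demazureWord_nil]
  | cons i ω ih =>
    have hlinear : demazure cs i (polyAct cs (cs.wordProd ω) (linearPoly φ)) =
        C (φ (cs.geometricRep (cs.wordProd ω)⁻¹ (simpleRoot i))) := by
      rw [polyAct_linearPoly, demazure_linearPoly, LinearMap.comp_apply, LinearEquiv.coe_coe]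
    have hsum : demazure cs i ((erasures cs ω).map fun p => φ p.1 • demazureWord cs p.2 f).sum =
        (((erasures cs ω).map (Prod.map id (List.cons i))).map
          fun p => φ p.1 • demazureWord cs p.2 f).sum := by
      rw [map_list_sum, List.map_map, List.map_map]
      congr 1
      refine List.map_congr_left fun p _ => ?_
      simp only [Function.comp_apply, Prod.map_fst, Prod.map_snd, id, map_smul, demazureWord_cons,
        Module.End.mul_apply]
    rw [demazureWord_cons, Module.End.mul_apply, ih, map_add, demazure_mul, hlinear, hsum,
      ← AlgHom.mul_apply, ← map_mul, ← wordProd_cons, erasures, List.map_cons, List.sum_cons,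
      smul_eq_C_mul, Module.End.mul_apply, add_comm (C _ * _), add_assoc]

end DemazureWord

/-! ### The operator of a group element -/

section DemazureOp

variable {B : Type*} [Fintype B] [DecidableEq B] {M : CoxeterMatrix B}
  {W : Type*} [Group W] (cs : CoxeterSystem M W)

/-- The divided difference operator of a group element, along a chosen reduced word. -/
def demazureOp (w : W) : Module.End ℝ (MvPolynomial B ℝ) :=
  demazureWord cs (cs.exists_isReduced w).choose

theorem exists_demazureOp_eq_demazureWord (w : W) :
    ∃ ω : List B, cs.IsReduced ω ∧ cs.wordProd ω = w ∧ demazureOp cs w = demazureWord cs ω :=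
  ⟨_, (cs.exists_isReduced w).choose_spec.1, (cs.exists_isReduced w).choose_spec.2.symm, rfl⟩

/-- By the Leibniz rule the difference of the two sides commutes with multiplication by linear
forms, up to the action, and it kills constants. -/
theorem demazureWord_eq_of_wordProd_eq {ω η : List B} {n : ℕ}
    {T : W → Module.End ℝ (MvPolynomial B ℝ)}
    (hT : ∀ ζ : List B, ζ.length = n → demazureWord cs ζ = T (cs.wordProd ζ))
    (hω : cs.IsReduced ω) (hη : cs.IsReduced η) (hωn : ω.length = n + 1)
    (h : cs.wordProd ω = cs.wordProd η) : demazureWord cs ω = demazureWord cs η := by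
  have hηn : η.length = n + 1 := by rw [← hωn, ← hω.eq, ← hη.eq, h]
  have hsum (ζ : List B) (hζ : ζ.length = n + 1) (f : MvPolynomial B ℝ)
      (φ : Module.Dual ℝ (B → ℝ)) :
      ((erasures cs ζ).map fun p => φ p.1 • demazureWord cs p.2 f).sum =
        (((erasures cs ζ).map (Prod.map id cs.wordProd)).map fun p => φ p.1 • T p.2 f).sum := by
    rw [List.map_map]
    congr 1
    refine List.map_congr_left fun p hp => ?_
    have hlen := length_of_mem_erasures hp
    rw [hT _ (by lia), Function.comp_apply, Prod.map_fst, Prod.map_snd, id]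
  refine LinearMap.ext fun f => ?_
  induction f using MvPolynomial.induction_on with
  | C a =>
    rw [demazureWord_eq_zero cs (isHomogeneous_C B a) (by lia),
      demazureWord_eq_zero cs (isHomogeneous_C B a) (by lia)]
  | add p q hp hq => rw [map_add, map_add, hp, hq]
  | mul_X p j hp =>
    rw [mul_comm, ← linearPoly_proj, demazureWord_linearPoly_mul, demazureWord_linearPoly_mul,
      hp, hsum ω hωn, hsum η hηn, h]
    exact congrArg _ ((map_wordProd_erasures_perm hω hη h).map _).sum_eq

/-- If `s_i` shortens `ω`, then `ω` may be replaced by a reduced word beginning with `i`, and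
`∂_i ∂_i = 0`. -/
theorem demazureWord_cons_eq_zero {ω : List B} {i : B} (hω : cs.IsReduced ω)
    (hi : ¬cs.IsReduced (i :: ω))
    (h : ∀ η : List B, η.length = ω.length → cs.IsReduced η → cs.wordProd ω = cs.wordProd η →
      demazureWord cs ω = demazureWord cs η) :
    demazureWord cs (i :: ω) = 0 := by
  rw [CoxeterSystem.IsReduced, wordProd_cons, List.length_cons, ← hω.eq] at hi
  have hlen := (cs.length_simple_mul (cs.wordProd ω) i).resolve_left hi
  obtain ⟨η, hη, hprod⟩ := cs.exists_isReduced (cs.simple i * cs.wordProd ω)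
  have hprod' : cs.wordProd ω = cs.wordProd (i :: η) := by
    rw [wordProd_cons, ← hprod, simple_mul_simple_cancel_left]
  have hηlen : (i :: η).length = ω.length := by
    rw [List.length_cons, ← hη.eq, ← hprod, hlen, hω.eq]
  have hηred : cs.IsReduced (i :: η) := by
    rw [CoxeterSystem.IsReduced, ← hprod', hηlen, hω.eq]
  rw [demazureWord_cons, h (i :: η) hηlen hηred hprod', demazureWord_cons]
  exact LinearMap.ext fun f => demazure_demazure cs i _

theorem demazureWord_eq_ite (ω : List B) :
    demazureWord cs ω =
      open Classical in if cs.IsReduced ω then demazureOp cs (cs.wordProd ω) else 0 := by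
  classical
  induction hn : ω.length generalizing ω with
  | zero =>
    rw [List.length_eq_zero_iff] at hn
    subst hn
    obtain ⟨ζ, hζ, hprod, hop⟩ := exists_demazureOp_eq_demazureWord cs (1 : W)
    have hζ0 : ζ = [] := by
      rw [← List.length_eq_zero_iff, ← hζ.eq, hprod, length_one]
    rw [if_pos (by simp [CoxeterSystem.IsReduced]), wordProd_nil, hop, hζ0]
  | succ n ih =>
    obtain ⟨i, ω, rfl⟩ := List.exists_cons_of_length_eq_add_one hn
    rw [List.length_cons, add_left_inj] at hn
    split_ifs with hred
    · obtain ⟨ζ, hζ, hprod, hop⟩ := exists_demazureOp_eq_demazureWord cs (cs.wordProd (i :: ω))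
      rw [hop]
      refine demazureWord_eq_of_wordProd_eq cs
        (T := fun w => if cs.length w = n then demazureOp cs w else 0) (fun η hη => ?_) hred hζ
        (by rw [List.length_cons, hn]) hprod.symm
      simp only [ih η hη, CoxeterSystem.IsReduced, hη]
    · by_cases hω : cs.IsReduced ω
      · refine demazureWord_cons_eq_zero cs hω hred fun η hη hηred hprod => ?_
        rw [ih ω hn, ih η (hη.trans hn), if_pos hω, if_pos hηred, hprod]
      · rw [demazureWord_cons, ih ω hn, if_neg hω, mul_zero]

theorem demazureOp_mul_demazureOp (u w : W) :
    demazureOp cs u * demazureOp cs w =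
      if cs.length (u * w) = cs.length u + cs.length w then demazureOp cs (u * w) else 0 := by
  obtain ⟨ω, hω, rfl, hopω⟩ := exists_demazureOp_eq_demazureWord cs u
  obtain ⟨η, hη, rfl, hopη⟩ := exists_demazureOp_eq_demazureWord cs w
  rw [hopω, hopη, ← demazureWord_append, demazureWord_eq_ite, CoxeterSystem.IsReduced,
    wordProd_append, hω.eq, hη.eq, List.length_append]
  congr

theorem demazureOp_simple (i : B) : demazureOp cs (cs.simple i) = demazure cs i := by
  have h := demazureWord_eq_ite cs [i]
  rw [if_pos (by simp [CoxeterSystem.IsReduced]), wordProd_singleton] at h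
  rw [← h, demazureWord_cons, demazureWord_nil, mul_one]

theorem demazureOp_one : demazureOp cs 1 = 1 := by
  have h := demazureWord_eq_ite cs []
  rwa [if_pos (by simp [CoxeterSystem.IsReduced]), wordProd_nil, demazureWord_nil, eq_comm] at h

theorem demazureOp_smul (w : W) (a : cs.invariants) (g : MvPolynomial B ℝ) :
    demazureOp cs w (a • g) = a • demazureOp cs w g :=
  demazureWord_smul cs _ a g

theorem isHomogeneous_demazureOp {w : W} {m : ℕ} {f : MvPolynomial B ℝ}
    (hf : f.IsHomogeneous (cs.length w + m)) : (demazureOp cs w f).IsHomogeneous m := by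
  obtain ⟨ω, hω, rfl, hop⟩ := exists_demazureOp_eq_demazureWord cs w
  rw [hω.eq] at hf
  exact hop ▸ isHomogeneous_demazureWord cs hf

theorem demazureOp_eq_zero {w : W} {n : ℕ} {f : MvPolynomial B ℝ}
    (hf : f.IsHomogeneous n) (hn : n < cs.length w) : demazureOp cs w f = 0 := by
  obtain ⟨ω, hω, rfl, hop⟩ := exists_demazureOp_eq_demazureWord cs w
  rw [hω.eq] at hn
  exact hop ▸ demazureWord_eq_zero cs hf hn

end DemazureOp

section Height

variable {B : Type*} [Fintype B]

variable (B) in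
/-- The height functional, the sum of the coordinates; it is positive on the positive roots. -/
def height : Module.Dual ℝ (B → ℝ) := ∑ j, LinearMap.proj j

theorem height_apply (v : B → ℝ) : height B v = ∑ j, v j := by
  simp [height]

theorem height_nonneg {v : B → ℝ} (hv : 0 ≤ v) : 0 ≤ height B v := by
  rw [height_apply]
  exact Finset.sum_nonneg fun j _ => hv j

theorem height_pos {v : B → ℝ} (hv : 0 ≤ v) (hv0 : v ≠ 0) : 0 < height B v := by
  obtain ⟨j, hj⟩ := Function.ne_iff.1 hv0
  rw [height_apply]
  exact Finset.sum_pos' (fun j _ => hv j) ⟨j, Finset.mem_univ j, (hv j).lt_of_ne' hj⟩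

variable [DecidableEq B] {M : CoxeterMatrix B} {W : Type*} [Group W] (cs : CoxeterSystem M W)

theorem isHomogeneous_linearPoly_height_pow (n : ℕ) :
    (linearPoly (height B) ^ n).IsHomogeneous n := by
  simpa using (isHomogeneous_linearPoly (height B)).pow n

theorem demazureWord_linearPoly_height_pow_succ {ω : List B} {n : ℕ} (hn : n < ω.length) :
    demazureWord cs ω (linearPoly (height B) ^ (n + 1)) =
      ((erasures cs ω).map fun p =>
        height B p.1 • demazureWord cs p.2 (linearPoly (height B) ^ n)).sum := by
  rw [pow_succ', demazureWord_linearPoly_mul,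
    demazureWord_eq_zero cs (isHomogeneous_linearPoly_height_pow n) hn, mul_zero, zero_add]

theorem height_nonneg_of_mem_erasures {ω : List B} (hω : cs.IsReduced ω)
    {p : (B → ℝ) × List B} (hp : p ∈ erasures cs ω) : 0 ≤ height B p.1 :=
  height_nonneg ((mem_map_fst_erasures hω p.1).1 (List.mem_map_of_mem hp)).2.1

theorem constantCoeff_demazureWord_linearPoly_height_pow_nonneg {n : ℕ} {ω : List B}
    (hn : ω.length = n) :
    0 ≤ constantCoeff (demazureWord cs ω (linearPoly (height B) ^ n)) := by
  classical
  induction n generalizing ω with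
  | zero => simp [List.length_eq_zero_iff.1 hn, demazureWord_nil]
  | succ n ih =>
    by_cases hω : cs.IsReduced ω
    · rw [demazureWord_linearPoly_height_pow_succ cs (by lia), map_list_sum, List.map_map]
      refine List.sum_nonneg (List.forall_mem_map.2 fun p hp => ?_)
      have hlen := length_of_mem_erasures hp
      rw [Function.comp_apply, constantCoeff_smul]
      exact smul_nonneg (height_nonneg_of_mem_erasures cs hω hp) (ih (by lia))
    · rw [demazureWord_eq_ite, if_neg hω, LinearMap.zero_apply, map_zero]

theorem constantCoeff_demazureWord_linearPoly_height_pow_pos {n : ℕ} {ω : List B}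
    (hω : cs.IsReduced ω) (hn : ω.length = n) :
    0 < constantCoeff (demazureWord cs ω (linearPoly (height B) ^ n)) := by
  induction n generalizing ω with
  | zero => simp [List.length_eq_zero_iff.1 hn, demazureWord_nil]
  | succ n ih =>
    rw [demazureWord_linearPoly_height_pow_succ cs (by lia), map_list_sum, List.map_map]
    have hterm_nonneg (p : (B → ℝ) × List B) (hp : p ∈ erasures cs ω) : 0 ≤ constantCoeff
        (height B p.1 • demazureWord cs p.2 (linearPoly (height B) ^ n)) := by
      have hlen := length_of_mem_erasures hp
      rw [constantCoeff_smul]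
      exact smul_nonneg (height_nonneg_of_mem_erasures cs hω hp)
        (constantCoeff_demazureWord_linearPoly_height_pow_nonneg cs (by lia))
    obtain ⟨i, ω, rfl⟩ := List.exists_cons_of_length_eq_add_one hn
    rw [erasures, List.forall_mem_cons] at hterm_nonneg
    rw [erasures, List.map_cons, List.sum_cons]
    refine add_pos_of_pos_of_nonneg ?_ (List.sum_nonneg (List.forall_mem_map.2 hterm_nonneg.2))
    rw [Function.comp_apply, constantCoeff_smul]
    refine smul_pos (height_pos ?_ ?_) (ih (by simpa using hω.drop 1) (by simpa using hn))
    · exact geometricRep_inv_simpleRoot_nonneg_of_isReduced_cons cs hω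
    · exact geometricRep_ne_zero cs _ (simpleRoot_ne_zero i)

end Height

/-! ### Freeness over the invariants -/

section LongestElement

variable {B : Type*} {M : CoxeterMatrix B} {W : Type*} [Group W] {cs : CoxeterSystem M W} {w₀ : W}

theorem geometricRep_nonpos_of_length_maximal [Fintype B] [DecidableEq B]
    (h : ∀ w, cs.length w ≤ cs.length w₀) {x : B → ℝ} (hx : 0 ≤ x) :
    cs.geometricRep w₀ x ≤ 0 := by
  rw [← sum_smul_simpleRoot x, map_sum]
  refine Finset.sum_nonpos fun i _ => ?_
  rw [map_smul]
  refine smul_nonpos_of_nonneg_of_nonpos (hx i) (geometricRep_simpleRoot_nonpos cs ?_)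
  exact lt_of_le_of_ne (h _) (cs.length_mul_simple_ne w₀ i)

theorem length_mul_add_length_of_length_maximal [Finite B] (h : ∀ w, cs.length w ≤ cs.length w₀)
    (v : W) : cs.length (w₀ * v) + cs.length v = cs.length w₀ := by
  classical
  have := Fintype.ofFinite B
  induction hn : cs.length v generalizing v with
  | zero => rw [cs.length_eq_zero_iff.1 hn, mul_one, add_zero]
  | succ n ih =>
    have hv : v ≠ 1 := by
      rintro rfl
      simp at hn
    obtain ⟨s, hs⟩ := cs.exists_rightDescent_of_ne_one hv
    have hdescent : cs.IsRightDescent (w₀ * (v * cs.simple s)) s := by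
      rw [isRightDescent_iff_geometricRep_nonpos, geometricRep_mul_apply]
      exact geometricRep_nonpos_of_length_maximal h
        (geometricRep_simpleRoot_nonneg cs (cs.isRightDescent_iff_not_isRightDescent_mul.1 hs))
    have hlen := cs.isRightDescent_iff.1 hdescent
    rw [mul_assoc, mul_assoc, simple_mul_simple_self, mul_one] at hlen
    have hlen_v := cs.isRightDescent_iff.1 hs
    have ih_v := ih (v * cs.simple s) (by lia)
    lia

theorem length_inv_mul_add_length_of_length_maximal [Finite B]
    (h : ∀ w, cs.length w ≤ cs.length w₀) (w : W) :
    cs.length (w⁻¹ * w₀) + cs.length w = cs.length w₀ := by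
  have hinv := length_mul_add_length_of_length_maximal (w₀ := w₀⁻¹) (by simpa using h) w
  rwa [← cs.length_inv (w₀⁻¹ * w), mul_inv_rev, inv_inv, cs.length_inv w₀] at hinv

end LongestElement

section DualFamily

variable {B : Type*} [Fintype B] [DecidableEq B] {M : CoxeterMatrix B}
  {W : Type*} [Group W] (cs : CoxeterSystem M W)

/-- Homogeneous polynomials `P w` of degree `ℓ w` that are dual, in each degree, to the divided
difference operators; the Schubert polynomials of `W`. -/
structure IsDualFamily (P : W → MvPolynomial B ℝ) : Prop where
  isHomogeneous (w : W) : (P w).IsHomogeneous (cs.length w)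
  demazureOp_self (w : W) : demazureOp cs w (P w) = 1
  demazureOp_of_ne {u w : W} : u ≠ w → cs.length u = cs.length w → demazureOp cs u (P w) = 0

theorem exists_isDualFamily [Finite W] : ∃ P : W → MvPolynomial B ℝ, IsDualFamily cs P := by
  obtain ⟨w₀, hmax⟩ := Finite.exists_max cs.length
  have hlen := length_inv_mul_add_length_of_length_maximal hmax
  set h := linearPoly (height B) ^ cs.length w₀
  have hhom : h.IsHomogeneous (cs.length w₀) := isHomogeneous_linearPoly_height_pow _
  set c := constantCoeff (demazureOp cs w₀ h) with hc
  have hc0 : c ≠ 0 := by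
    obtain ⟨ω, hω, hprod, hop⟩ := exists_demazureOp_eq_demazureWord cs w₀
    rw [hc, hop]
    exact (constantCoeff_demazureWord_linearPoly_height_pow_pos cs hω
      (by rw [← hω.eq, hprod])).ne'
  have htop : demazureOp cs w₀ h = C c := eq_C_constantCoeff_of_isHomogeneous_zero
    (isHomogeneous_demazureOp cs (by rwa [add_zero]))
  refine ⟨fun w => c⁻¹ • demazureOp cs (w⁻¹ * w₀) h, fun w => ?_, fun w => ?_,
    fun {u w} hne hl => ?_⟩
  · rw [smul_eq_C_mul]
    exact (isHomogeneous_demazureOp cs (by rwa [hlen])).C_mul _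
  · rw [map_smul, ← Module.End.mul_apply, demazureOp_mul_demazureOp, mul_inv_cancel_left,
      if_pos (by rw [← hlen w, add_comm]), htop, smul_eq_C_mul, ← C_mul, inv_mul_cancel₀ hc0, C_1]
  · rw [map_smul, ← Module.End.mul_apply, demazureOp_mul_demazureOp, if_neg, LinearMap.zero_apply,
      smul_zero]
    intro hadd
    have hcompl := hlen (w * u⁻¹)
    rw [mul_inv_rev, inv_inv, mul_assoc, hadd, hl] at hcompl
    have hlen_w := hlen w
    exact hne (mul_inv_eq_one.1 (cs.length_eq_zero_iff.1 (by lia))).symm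

namespace IsDualFamily

variable {cs} {P : W → MvPolynomial B ℝ} (hP : IsDualFamily cs P)

include hP

theorem demazureOp_sum_smul [DecidableEq W] {s : Finset W} {u : W}
    (hs : ∀ w ∈ s, cs.length w ≤ cs.length u) (g : W → cs.invariants) :
    demazureOp cs u (∑ w ∈ s, g w • P w) = if u ∈ s then (g u : MvPolynomial B ℝ) else 0 := by
  rw [map_sum, ← Finset.sum_ite_eq s u fun w => (g w : MvPolynomial B ℝ)]
  refine Finset.sum_congr rfl fun w hw => ?_
  rw [demazureOp_smul]
  split_ifs with huw
  · rw [huw, hP.demazureOp_self, Subalgebra.smul_def, smul_eq_mul, mul_one]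
  · rcases (hs w hw).lt_or_eq with hlt | heq
    · rw [demazureOp_eq_zero cs (hP.isHomogeneous w) hlt, smul_zero]
    · rw [hP.demazureOp_of_ne huw heq.symm, smul_zero]

theorem linearIndependent : LinearIndependent cs.invariants P := by
  classical
  rw [linearIndependent_iff'']
  intro s g hgs hsum
  by_contra! hne
  obtain ⟨w, hw⟩ := hne
  have hsupp : (s.filter fun v => g v ≠ 0).Nonempty :=
    ⟨w, Finset.mem_filter.2 ⟨by_contra fun hws => hw (hgs w hws), hw⟩⟩
  obtain ⟨u, hu, hmax⟩ := Finset.exists_max_image _ cs.length hsupp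
  have hsum_filter : ∑ v ∈ s with g v ≠ 0, g v • P v = 0 := by
    rw [Finset.sum_filter_of_ne fun v _ => left_ne_zero_of_smul, hsum]
  have htop := hP.demazureOp_sum_smul hmax g
  rw [hsum_filter, map_zero, if_pos hu] at htop
  exact (Finset.mem_filter.1 hu).2 (Subtype.ext htop.symm)

end IsDualFamily

variable {cs}

theorem demazureOp_mem_invariants {u : W} {f : MvPolynomial B ℝ}
    (hf : ∀ v, cs.length u < cs.length v → demazureOp cs v f = 0) :
    demazureOp cs u f ∈ cs.invariants := by
  rw [mem_invariants_iff_demazure]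
  intro i
  rw [← demazureOp_simple, ← Module.End.mul_apply, demazureOp_mul_demazureOp]
  split_ifs with h
  · exact hf _ (by rw [h, length_simple]; lia)
  · rfl

namespace IsDualFamily

variable {P : W → MvPolynomial B ℝ} (hP : IsDualFamily cs P)

include hP

theorem mem_span_of_demazureOp_eq_zero [Finite W] {n : ℕ} {f : MvPolynomial B ℝ}
    (hf : ∀ u, n ≤ cs.length u → demazureOp cs u f = 0) :
    f ∈ Submodule.span cs.invariants (Set.range P) := by
  classical
  have := Fintype.ofFinite W
  induction n generalizing f with
  | zero =>
    have hf1 := hf 1 (Nat.zero_le _)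
    rw [demazureOp_one, Module.End.one_apply] at hf1
    exact hf1 ▸ Submodule.zero_mem _
  | succ n ih =>
    have hcoeff (u : W) : ∃ a : cs.invariants, cs.length u = n → a = demazureOp cs u f := by
      by_cases hu : cs.length u = n
      · exact ⟨⟨_, demazureOp_mem_invariants fun v hv => hf v (by lia)⟩, fun _ => rfl⟩
      · exact ⟨0, fun h => absurd h hu⟩
    choose g hg using hcoeff
    set leading := ∑ w with cs.length w = n, g w • P w with hleading
    have hspan : leading ∈ Submodule.span cs.invariants (Set.range P) :=
      Submodule.sum_mem _ fun w _ =>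
        Submodule.smul_mem _ _ (Submodule.subset_span (Set.mem_range_self w))
    refine (Submodule.sub_mem_iff_left _ hspan).1 (ih fun u hu => ?_)
    rw [map_sub, hleading, hP.demazureOp_sum_smul (fun w hw => (Finset.mem_filter.1 hw).2 ▸ hu)]
    simp only [Finset.mem_filter_univ]
    split_ifs with hun
    · rw [hg u hun, sub_self]
    · rw [sub_zero, hf u (by lia)]

end IsDualFamily

theorem exists_homogeneous_basis_over_invariants [Finite W] :
    ∃ b : Module.Basis W cs.invariants (MvPolynomial B ℝ),
      ∀ w, (b w).IsHomogeneous (cs.length w) := by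
  obtain ⟨P, hP⟩ := exists_isDualFamily cs
  obtain ⟨w₀, hmax⟩ := Finite.exists_max cs.length
  have hspan : ⊤ ≤ Submodule.span cs.invariants (Set.range P) := fun f _ =>
    hP.mem_span_of_demazureOp_eq_zero (n := cs.length w₀ + 1) fun u hu =>
      absurd (hmax u) (by lia)
  exact ⟨.mk hP.linearIndependent hspan, fun w => by
    rw [Module.Basis.mk_apply]
    exact hP.isHomogeneous w⟩

end DualFamily

/-! ### Counting by degree -/

section CountingSeries

variable {ι κ : Type*} {D : ι → ℕ} {E : κ → ℕ}

/-- The generating function `∑ i, X ^ D i` of a grading with finite fibres; infinite fibres count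
as `0`. -/
def countingSeries (D : ι → ℕ) : PowerSeries ℤ := .mk fun k => Nat.card {i // D i = k}

theorem coeff_countingSeries (k : ℕ) :
    PowerSeries.coeff k (countingSeries D) = Nat.card {i // D i = k} :=
  PowerSeries.coeff_mk _ _

theorem countingSeries_comp_equiv (e : κ ≃ ι) : countingSeries (D ∘ e) = countingSeries D := by
  ext k
  rw [coeff_countingSeries, coeff_countingSeries]
  exact congrArg _ (Nat.card_congr (e.subtypeEquiv (q := fun i => D i = k) fun _ => Iff.rfl))

theorem countingSeries_ne_zero [Nonempty ι] (hD : ∀ k, Finite {i // D i = k}) :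
    countingSeries D ≠ 0 := by
  intro h
  obtain ⟨i⟩ := ‹Nonempty ι›
  have hcoeff := congrArg (PowerSeries.coeff (D i)) h
  have : Nonempty {j // D j = D i} := ⟨⟨i, rfl⟩⟩
  rw [coeff_countingSeries, map_zero, Nat.cast_eq_zero] at hcoeff
  exact Nat.card_pos.ne' hcoeff

variable (D E) in
/-- A pair of total degree `k` is a splitting of `k` and a pair with these degrees. -/
def fiberAddEquiv (k : ℕ) : {p : ι × κ // D p.1 + E p.2 = k} ≃
    Σ c : Finset.HasAntidiagonal.antidiagonal k, {i // D i = c.1.1} × {j // E j = c.1.2} where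
  toFun p := ⟨⟨(D p.1.1, E p.1.2), Finset.HasAntidiagonal.mem_antidiagonal.2 p.2⟩,
    ⟨p.1.1, rfl⟩, ⟨p.1.2, rfl⟩⟩
  invFun x := ⟨(x.2.1, x.2.2), by
    rw [x.2.1.2, x.2.2.2]
    exact Finset.HasAntidiagonal.mem_antidiagonal.1 x.1.2⟩
  left_inv _ := rfl
  right_inv := by
    rintro ⟨⟨⟨_, _⟩, _⟩, ⟨_, hD⟩, ⟨_, hE⟩⟩
    cases hD
    cases hE
    rfl

theorem countingSeries_prod (hD : ∀ k, Finite {i // D i = k}) (hE : ∀ k, Finite {j // E j = k}) :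
    countingSeries (fun p : ι × κ => D p.1 + E p.2) = countingSeries D * countingSeries E := by
  ext k
  simp only [PowerSeries.coeff_mul, coeff_countingSeries]
  rw [Nat.card_congr (fiberAddEquiv D E k), Nat.card_sigma]
  simp only [Nat.card_prod, Nat.cast_sum, Nat.cast_mul]
  exact Finset.sum_coe_sort (Finset.HasAntidiagonal.antidiagonal k) fun c =>
    (Nat.card {i // D i = c.1} : ℤ) * Nat.card {j // E j = c.2}

theorem exists_equiv_of_countingSeries_eq (hD : ∀ k, Finite {i // D i = k})
    (hE : ∀ k, Finite {j // E j = k}) (h : countingSeries D = countingSeries E) :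
    ∃ e : ι ≃ κ, ∀ i, E (e i) = D i := by
  have hfiber (k : ℕ) : Nonempty ({i // D i = k} ≃ {j // E j = k}) := by
    have hcoeff := congrArg (PowerSeries.coeff k) h
    rw [coeff_countingSeries, coeff_countingSeries, Nat.cast_inj] at hcoeff
    exact Finite.card_eq.1 hcoeff
  exact ⟨.ofFiberEquiv fun k => (hfiber k).some, Equiv.ofFiberEquiv_map _⟩

theorem finite_fiber_weight [Finite ι] (d : ι → ℕ) [∀ i, NeZero (d i)] (k : ℕ) :
    Finite {a : ι →₀ ℕ // Finsupp.weight d a = k} :=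
  (Finsupp.finite_of_nat_weight_le d (fun _ => NeZero.ne _) k).subset fun _ => le_of_eq

/-- Division with remainder in each coordinate: this is
`∏ 1 / (1 - X) = ∏ 1 / (1 - X ^ d i) * ∏ (1 + X + ⋯ + X ^ (d i - 1))`. -/
theorem countingSeries_degree [Fintype ι] (d : ι → ℕ) [∀ i, NeZero (d i)] :
    countingSeries (Finsupp.degree : (ι →₀ ℕ) → ℕ) =
      countingSeries (Finsupp.weight d : (ι →₀ ℕ) → ℕ) *
        countingSeries fun a : ∀ i, Fin (d i) => ∑ i, (a i : ℕ) := by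
  rw [← countingSeries_prod (finite_fiber_weight d) fun _ => inferInstance]
  let e : (ι →₀ ℕ) ≃ (ι →₀ ℕ) × ∀ i, Fin (d i) :=
    Finsupp.equivFunOnFinite.trans <| (Equiv.piCongrRight fun i => Nat.divModEquiv (d i)).trans <|
      (Equiv.arrowProdEquivProdArrow ι _ _).trans <|
        Finsupp.equivFunOnFinite.symm.prodCongr (.refl _)
  rw [← countingSeries_comp_equiv e]
  congr 1
  ext a
  simp [e, Finsupp.weight_apply, Finsupp.sum_fintype, Finsupp.degree_eq_sum, Nat.divModEquiv,
    ← Finset.sum_add_distrib, Nat.div_add_mod']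

end CountingSeries

section HomogeneousBasis

variable {σ ι κ R : Type*} [CommRing R]

theorem span_homogeneous_basis (b : Module.Basis ι R (MvPolynomial σ R)) {D : ι → ℕ}
    (hb : ∀ i, (b i).IsHomogeneous (D i)) (k : ℕ) :
    Submodule.span R (Set.range fun i : {i // D i = k} => b i) = homogeneousSubmodule σ R k := by
  refine le_antisymm (Submodule.span_le.2 ?_) fun f hf => ?_
  · rintro _ ⟨⟨i, rfl⟩, rfl⟩
    exact hb i
  · rw [← homogeneousComponent_eq_self hf, ← b.linearCombination_repr f,
      Finsupp.linearCombination_apply, Finsupp.sum, map_sum]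
    refine Submodule.sum_mem _ fun i _ => ?_
    rw [map_smul, homogeneousComponent_of_mem (hb i)]
    refine Submodule.smul_mem _ _ ?_
    split_ifs with hk
    · exact Submodule.subset_span ⟨⟨i, hk.symm⟩, rfl⟩
    · exact Submodule.zero_mem _

theorem exists_homogeneous_basis_of_algebraicIndependent {f : ι → MvPolynomial σ R} {d : ι → ℕ}
    (hf : ∀ i, (f i).IsHomogeneous (d i)) (hind : AlgebraicIndependent R f)
    {S : Subalgebra R (MvPolynomial σ R)} (hS : Algebra.adjoin R (Set.range f) = S)
    (b : Module.Basis κ S (MvPolynomial σ R)) {D : κ → ℕ} (hb : ∀ j, (b j).IsHomogeneous (D j)) :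
    ∃ b' : Module.Basis ((ι →₀ ℕ) × κ) R (MvPolynomial σ R),
      ∀ p, (b' p).IsHomogeneous (Finsupp.weight d p.1 + D p.2) := by
  subst hS
  refine ⟨((basisMonomials ι R).map hind.aevalEquiv.toLinearEquiv).smulTower b, fun p => ?_⟩
  have hmonomial : (((basisMonomials ι R).map hind.aevalEquiv.toLinearEquiv p.1 :
      Algebra.adjoin R (Set.range f)) : MvPolynomial σ R) = p.1.prod fun i k => f i ^ k := by
    rw [Module.Basis.map_apply, coe_basisMonomials, AlgEquiv.toLinearEquiv_apply,
      hind.aevalEquiv_apply_coe, aeval_monomial, map_one, one_mul]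
  rw [Module.Basis.smulTower_apply, Subalgebra.smul_def, smul_eq_mul, hmonomial]
  refine IsHomogeneous.mul (IsHomogeneous.prod _ _ _ fun i _ => ?_) (hb _)
  simpa [mul_comm] using (hf i).pow (p.1 i)

variable [Nontrivial R]

theorem countingSeries_homogeneous_basis (b : Module.Basis ι R (MvPolynomial σ R)) {D : ι → ℕ}
    (hb : ∀ i, (b i).IsHomogeneous (D i)) :
    countingSeries D = .mk fun k => (Module.finrank R (homogeneousSubmodule σ R k) : ℤ) := by
  ext k
  have hli : LinearIndependent R fun i : {i // D i = k} => b i :=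
    b.linearIndependent.comp _ Subtype.val_injective
  rw [coeff_countingSeries, PowerSeries.coeff_mk, ← span_homogeneous_basis b hb,
    Module.finrank_eq_nat_card_basis (Module.Basis.span hli)]

theorem countingSeries_homogeneous_basis_eq_degree
    (b : Module.Basis ι R (MvPolynomial σ R)) {D : ι → ℕ} (hb : ∀ i, (b i).IsHomogeneous (D i)) :
    countingSeries D = countingSeries (Finsupp.degree : (σ →₀ ℕ) → ℕ) := by
  have hmonomial (a : σ →₀ ℕ) : (basisMonomials σ R a).IsHomogeneous a.degree := by
    rw [coe_basisMonomials]
    exact isHomogeneous_monomial _ rfl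
  rw [countingSeries_homogeneous_basis b hb, countingSeries_homogeneous_basis _ hmonomial]

theorem pos_of_isHomogeneous_of_algebraicIndependent {f : ι → MvPolynomial σ R} {i : ι} {n : ℕ}
    (hf : AlgebraicIndependent R f) (hi : (f i).IsHomogeneous n) : 0 < n := by
  rw [Nat.pos_iff_ne_zero]
  rintro rfl
  refine hf.transcendental i ?_
  rw [eq_C_constantCoeff_of_isHomogeneous_zero hi]
  exact isAlgebraic_algebraMap _

end HomogeneousBasis

section Degrees

variable {B : Type*} [Fintype B] [DecidableEq B] {M : CoxeterMatrix B}
  {W : Type*} [Group W] {cs : CoxeterSystem M W} {d : Fin (Fintype.card B) → ℕ}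

theorem neZero_of_isDegrees (hd : cs.IsDegrees d) (i : Fin (Fintype.card B)) : NeZero (d i) := by
  obtain ⟨f, hf, hind, -⟩ := hd
  exact .of_pos (pos_of_isHomogeneous_of_algebraicIndependent hind (hf i))

theorem countingSeries_length [Finite W] (hd : cs.IsDegrees d) :
    countingSeries cs.length = countingSeries fun a : ∀ i, Fin (d i) => ∑ i, (a i : ℕ) := by
  have := neZero_of_isDegrees hd
  obtain ⟨f, hf, hind, hadj⟩ := hd
  obtain ⟨b, hb⟩ := exists_homogeneous_basis_over_invariants (cs := cs)
  obtain ⟨b', hb'⟩ := exists_homogeneous_basis_of_algebraicIndependent hf hind hadj b hb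
  have hreindex : countingSeries (Finsupp.degree : (B →₀ ℕ) → ℕ) =
      countingSeries (Finsupp.degree : (Fin (Fintype.card B) →₀ ℕ) → ℕ) := by
    rw [← countingSeries_comp_equiv (Finsupp.domCongr (Fintype.equivFin B)).toEquiv]
    congr 1
    ext a
    simp [Finsupp.degree_eq_sum, Equiv.sum_comp]
  apply mul_left_cancel₀ (countingSeries_ne_zero (finite_fiber_weight d))
  rw [← countingSeries_prod (finite_fiber_weight d) fun _ => inferInstance,
    countingSeries_homogeneous_basis_eq_degree b' hb', hreindex, countingSeries_degree d]

theorem exists_equiv_pi_fin_sum_eq_length [Finite W] (hd : cs.IsDegrees d) :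
    ∃ e : W ≃ ∀ i, Fin (d i), ∀ w, ∑ i, (e w i : ℕ) = cs.length w :=
  exists_equiv_of_countingSeries_eq (fun _ => inferInstance) (fun _ => inferInstance)
    (countingSeries_length hd)

end Degrees

/-! ### Gibbs measures -/

section GibbsMeasure

variable {α : Type*} [Fintype α] [MeasurableSpace α] {q : ℝ}

/-- The Gibbs measure of an energy function `E` on a finite type: `a` has mass proportional to
`q ^ E a`. The Mallows measure is the case of the length function, and the truncated geometric
distribution that of the inclusion `Fin d → ℕ`. -/
def gibbsMeasure (q : ℝ) (E : α → ℕ) : Measure α :=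
  ∑ a, ENNReal.ofReal (q ^ E a / ∑ b, q ^ E b) • Measure.dirac a

theorem isProbabilityMeasure_gibbsMeasure [Nonempty α] (hq : 0 < q) (E : α → ℕ) :
    IsProbabilityMeasure (gibbsMeasure q E) := by
  have hsum : 0 < ∑ a, q ^ E a := Finset.sum_pos (fun _ _ => pow_pos hq _) Finset.univ_nonempty
  constructor
  simp only [gibbsMeasure, Measure.finsetSum_apply, Measure.smul_apply, measure_univ, smul_eq_mul,
    mul_one]
  rw [← ENNReal.ofReal_sum_of_nonneg fun a _ => by positivity, ← Finset.sum_div,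
    div_self hsum.ne', ENNReal.ofReal_one]

variable [MeasurableSingletonClass α]

theorem gibbsMeasure_singleton (q : ℝ) (E : α → ℕ) (a : α) :
    gibbsMeasure q E {a} = ENNReal.ofReal (q ^ E a / ∑ b, q ^ E b) := by
  classical
  rw [gibbsMeasure, Measure.finsetSum_apply, Finset.sum_eq_single a]
  · simp
  · intro b _ hb
    simp [hb]
  · simp

theorem integral_gibbsMeasure (hq : 0 ≤ q) (E : α → ℕ) (g : α → ℝ) :
    ∫ a, g a ∂(gibbsMeasure q E) = (∑ a, q ^ E a * g a) / ∑ a, q ^ E a := by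
  have hmass (a : α) : 0 ≤ q ^ E a / ∑ b, q ^ E b := by positivity
  rw [gibbsMeasure, integral_finsetSum_measure fun a _ =>
    (integrable_dirac (by simp)).smul_measure ENNReal.ofReal_ne_top, Finset.sum_div]
  refine Finset.sum_congr rfl fun a _ => ?_
  rw [integral_smul_measure, integral_dirac, ENNReal.toReal_ofReal (hmass a), smul_eq_mul,
    div_mul_eq_mul_div]

theorem mgf_gibbsMeasure (hq : 0 ≤ q) (E : α → ℕ) (t : ℝ) :
    mgf (fun a => (E a : ℝ)) (gibbsMeasure q E) t =
      (∑ a, (Real.exp t * q) ^ E a) / ∑ a, q ^ E a := by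
  rw [mgf, integral_gibbsMeasure hq]
  congr 1
  refine Finset.sum_congr rfl fun a _ => ?_
  rw [mul_pow, ← Real.exp_nat_mul, mul_comm t, mul_comm]

end GibbsMeasure

section AdditiveEnergy

variable {α ι : Type*} [Fintype α] [Fintype ι] {β : ι → Type*} [∀ i, Fintype (β i)]
  {E : α → ℕ} {F : ∀ i, β i → ℕ} {e : α ≃ ∀ i, β i} {q : ℝ}

theorem sum_pow_eq_prod_sum_pow (he : ∀ a, ∑ i, F i (e a i) = E a) (q : ℝ) :
    ∑ a, q ^ E a = ∏ i, ∑ b, q ^ F i b := by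
  classical
  rw [Finset.prod_univ_sum, Fintype.piFinset_univ, ← e.sum_comp]
  refine Finset.sum_congr rfl fun a _ => ?_
  rw [Finset.prod_pow_eq_pow_sum, he]

variable [MeasurableSpace α] [MeasurableSingletonClass α] [∀ i, MeasurableSpace (β i)]
  [∀ i, MeasurableSingletonClass (β i)] [∀ i, Nonempty (β i)]

theorem measurePreserving_gibbsMeasure_pi (hq : 0 < q) (he : ∀ a, ∑ i, F i (e a i) = E a) :
    MeasurePreserving e (gibbsMeasure q E) (Measure.pi fun i => gibbsMeasure q (F i)) := by
  have := fun i => isProbabilityMeasure_gibbsMeasure hq (F i)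
  refine ⟨measurable_of_finite _, Measure.ext_of_singleton fun b => ?_⟩
  obtain ⟨a, rfl⟩ := e.surjective b
  have hpre : e ⁻¹' {e a} = {a} := by
    ext x
    simp
  rw [Measure.map_apply (measurable_of_finite _) (measurableSet_singleton _), hpre,
    Measure.pi_singleton]
  simp only [gibbsMeasure_singleton]
  rw [sum_pow_eq_prod_sum_pow he, ← he, ← Finset.prod_pow_eq_pow_sum, ← Finset.prod_div_distrib,
    ENNReal.ofReal_prod_of_nonneg fun i _ => by positivity]

theorem measurePreserving_gibbsMeasure_coordinate (hq : 0 < q)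
    (he : ∀ a, ∑ i, F i (e a i) = E a) (i : ι) :
    MeasurePreserving (fun a => e a i) (gibbsMeasure q E) (gibbsMeasure q (F i)) := by
  have := fun i => isProbabilityMeasure_gibbsMeasure hq (F i)
  exact (measurePreserving_eval (fun i => gibbsMeasure q (F i)) i).comp
    (measurePreserving_gibbsMeasure_pi hq he)

omit [∀ i, Fintype (β i)] in
theorem iIndepFun_gibbsMeasure_coordinate [∀ i, Finite (β i)] (hq : 0 < q)
    (he : ∀ a, ∑ i, F i (e a i) = E a) :
    iIndepFun (fun i a => F i (e a i)) (gibbsMeasure q E) := by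
  have := fun i => Fintype.ofFinite (β i)
  have : Nonempty α := e.nonempty
  have := isProbabilityMeasure_gibbsMeasure hq E
  have hcoordinates : iIndepFun (fun i a => e a i) (gibbsMeasure q E) := by
    rw [iIndepFun_iff_map_fun_eq_pi_map fun i => (measurable_of_finite _).aemeasurable]
    simp only [(measurePreserving_gibbsMeasure_coordinate hq he _).map_eq]
    exact (measurePreserving_gibbsMeasure_pi hq he).map_eq
  exact hcoordinates.comp F fun _ => measurable_of_finite _

theorem mgf_gibbsMeasure_coordinate (hq : 0 < q) (he : ∀ a, ∑ i, F i (e a i) = E a) (i : ι)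
    (t : ℝ) :
    mgf (fun a => (F i (e a i) : ℝ)) (gibbsMeasure q E) t =
      (∑ b, (Real.exp t * q) ^ F i b) / ∑ b, q ^ F i b := by
  rw [← mgf_gibbsMeasure hq.le, ← (measurePreserving_gibbsMeasure_coordinate hq he i).map_eq,
    mgf_map (measurable_of_finite _).aemeasurable (measurable_of_finite _).aestronglyMeasurable]
  rfl

theorem integral_energy_gibbsMeasure (hq : 0 < q) (he : ∀ a, ∑ i, F i (e a i) = E a) :
    ∫ a, (E a : ℝ) ∂(gibbsMeasure q E) = ∑ i, ∫ b, (F i b : ℝ) ∂(gibbsMeasure q (F i)) := by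
  have : Nonempty α := e.nonempty
  have := isProbabilityMeasure_gibbsMeasure hq E
  simp only [← he, Nat.cast_sum]
  rw [integral_finsetSum _ fun i _ => Integrable.of_finite]
  refine Finset.sum_congr rfl fun i _ => ?_
  rw [← (measurePreserving_gibbsMeasure_coordinate hq he i).map_eq,
    integral_map (measurable_of_finite _).aemeasurable
      (measurable_of_finite _).aestronglyMeasurable]

theorem variance_energy_gibbsMeasure (hq : 0 < q) (he : ∀ a, ∑ i, F i (e a i) = E a) :
    Var[fun a => (E a : ℝ); gibbsMeasure q E] =
      ∑ i, Var[fun b => (F i b : ℝ); gibbsMeasure q (F i)] := by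
  have := fun i => isProbabilityMeasure_gibbsMeasure hq (F i)
  rw [← variance_sum_pi fun i => MemLp.of_discrete, ← (measurePreserving_gibbsMeasure_pi hq
    he).variance_fun_comp (measurable_of_finite _).aemeasurable]
  simp only [← he, Nat.cast_sum, Finset.sum_apply]

end AdditiveEnergy

section TruncatedGeometric

variable {q : ℝ}

theorem sum_range_pow_mul_id (q : ℝ) (d : ℕ) :
    (∑ k ∈ Finset.range d, q ^ k * (k : ℝ)) * (1 - q) ^ 2 =
      q * (1 - q ^ d) - d * q ^ d * (1 - q) := by
  induction d with
  | zero => simp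
  | succ d ih =>
    rw [Finset.sum_range_succ, add_mul, ih]
    push_cast
    ring

theorem sum_range_pow_mul_sq (q : ℝ) (d : ℕ) :
    (∑ k ∈ Finset.range d, q ^ k * (k : ℝ) ^ 2) * (1 - q) ^ 3 =
      (q + q ^ 2) * (1 - q ^ d) - 2 * d * q * q ^ d * (1 - q) - d ^ 2 * q ^ d * (1 - q) ^ 2 := by
  induction d with
  | zero => simp
  | succ d ih =>
    rw [Finset.sum_range_succ, add_mul, ih]
    push_cast
    ring

theorem one_sub_pow_ne_zero {d : ℕ} (hd : d ≠ 0) (hq : 0 ≤ q) (hq1 : q ≠ 1) : 1 - q ^ d ≠ 0 :=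
  sub_ne_zero.2 fun h => hq1 ((pow_eq_one_iff_of_nonneg hq hd).1 h.symm)

theorem integral_gibbsMeasure_fin (hq : 0 ≤ q) (hq1 : q ≠ 1) (d : ℕ) (g : ℕ → ℝ) :
    ∫ k : Fin d, g k ∂(gibbsMeasure q Fin.val) =
      (∑ k ∈ Finset.range d, q ^ k * g k) / ((1 - q ^ d) / (1 - q)) := by
  rw [integral_gibbsMeasure hq, ← Finset.sum_range fun k => q ^ k * g k,
    ← Finset.sum_range fun k => q ^ k, geom_sum_eq hq1, ← neg_div_neg_eq (q ^ d - 1), neg_sub,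
    neg_sub]

variable {d : ℕ} [NeZero d]

theorem integral_id_gibbsMeasure_fin (hq : 0 ≤ q) (hq1 : q ≠ 1) :
    ∫ k : Fin d, ((k : ℕ) : ℝ) ∂(gibbsMeasure q Fin.val) =
      q / (1 - q) - d * q ^ d / (1 - q ^ d) := by
  have h1 : 1 - q ≠ 0 := sub_ne_zero.2 hq1.symm
  have hd := one_sub_pow_ne_zero (NeZero.ne d) hq hq1
  rw [integral_gibbsMeasure_fin hq hq1 d fun k => (k : ℝ),
    eq_div_of_mul_eq (pow_ne_zero 2 h1) (sum_range_pow_mul_id q d)]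
  field_simp

theorem integral_sq_gibbsMeasure_fin (hq : 0 ≤ q) (hq1 : q ≠ 1) :
    ∫ k : Fin d, ((k : ℕ) : ℝ) ^ 2 ∂(gibbsMeasure q Fin.val) =
      (q + q ^ 2) / (1 - q) ^ 2 - 2 * d * q * q ^ d / ((1 - q) * (1 - q ^ d)) -
        d ^ 2 * q ^ d / (1 - q ^ d) := by
  have h1 : 1 - q ≠ 0 := sub_ne_zero.2 hq1.symm
  have hd := one_sub_pow_ne_zero (NeZero.ne d) hq hq1
  rw [integral_gibbsMeasure_fin hq hq1 d fun k => (k : ℝ) ^ 2,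
    eq_div_of_mul_eq (pow_ne_zero 3 h1) (sum_range_pow_mul_sq q d)]
  field_simp

theorem variance_gibbsMeasure_fin (hq : 0 < q) (hq1 : q ≠ 1) :
    Var[fun k : Fin d => ((k : ℕ) : ℝ); gibbsMeasure q Fin.val] =
      q / (1 - q) ^ 2 - d ^ 2 * q ^ d / (1 - q ^ d) ^ 2 := by
  have := isProbabilityMeasure_gibbsMeasure hq (Fin.val : Fin d → ℕ)
  have h1 : 1 - q ≠ 0 := sub_ne_zero.2 hq1.symm
  have hd := one_sub_pow_ne_zero (NeZero.ne d) hq.le hq1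
  rw [variance_eq_sub MemLp.of_discrete]
  simp only [Pi.pow_apply]
  rw [integral_id_gibbsMeasure_fin hq.le hq1, integral_sq_gibbsMeasure_fin hq.le hq1]
  field_simp
  ring

end TruncatedGeometric

section PiFin

variable {α ι : Type*} [Fintype α] [MeasurableSpace α] [MeasurableSingletonClass α] [Fintype ι]
  {E : α → ℕ} {d : ι → ℕ} [∀ i, NeZero (d i)] {e : α ≃ ∀ i, Fin (d i)} {q : ℝ}

theorem mgf_gibbsMeasure_coordinate_fin (hq : 0 < q) (he : ∀ a, ∑ i, (e a i : ℕ) = E a) (i : ι)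
    (t : ℝ) :
    mgf (fun a => ((e a i : ℕ) : ℝ)) (gibbsMeasure q E) t =
      (∑ k ∈ Finset.range (d i), (Real.exp t * q) ^ k) / ∑ k ∈ Finset.range (d i), q ^ k := by
  rw [mgf_gibbsMeasure_coordinate (F := fun _ => Fin.val) hq he, Finset.sum_range,
    Finset.sum_range]

theorem integral_energy_gibbsMeasure_fin (hq : 0 < q) (hq1 : q ≠ 1)
    (he : ∀ a, ∑ i, (e a i : ℕ) = E a) :
    ∫ a, (E a : ℝ) ∂(gibbsMeasure q E) =
      Fintype.card ι * q / (1 - q) - ∑ i, d i * q ^ d i / (1 - q ^ d i) := by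
  rw [integral_energy_gibbsMeasure (F := fun _ => Fin.val) hq he]
  simp only [integral_id_gibbsMeasure_fin hq.le hq1]
  rw [Finset.sum_sub_distrib, Finset.sum_const, Finset.card_univ, nsmul_eq_mul, mul_div_assoc]

theorem variance_energy_gibbsMeasure_fin (hq : 0 < q) (hq1 : q ≠ 1)
    (he : ∀ a, ∑ i, (e a i : ℕ) = E a) :
    Var[fun a => (E a : ℝ); gibbsMeasure q E] =
      Fintype.card ι * q / (1 - q) ^ 2 - ∑ i, d i ^ 2 * q ^ d i / (1 - q ^ d i) ^ 2 := by
  rw [variance_energy_gibbsMeasure (F := fun _ => Fin.val) hq he]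
  simp only [variance_gibbsMeasure_fin hq hq1]
  rw [Finset.sum_sub_distrib, Finset.sum_const, Finset.card_univ, nsmul_eq_mul, mul_div_assoc]

end PiFin

end

end CoxeterLength


theorem mainTheorem11 {B W : Type*} [Fintype B] [DecidableEq B] [Group W] [Fintype W]
    [MeasurableSpace W] [MeasurableSingletonClass W]
    {M : CoxeterMatrix B} (cs : CoxeterSystem M W)
    (d : Fin (Fintype.card B) → ℕ) (hd : cs.IsDegrees d) (q : ℝ) (hq : 0 < q) :
    IsProbabilityMeasure (cs.mallows q) ∧
    (∃ Z : Fin (Fintype.card B) → W → ℕ,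
      iIndepFun Z (cs.mallows q) ∧
      (∀ w, cs.length w = ∑ i, Z i w) ∧
      (∀ i (t : ℝ), mgf (fun w => (Z i w : ℝ)) (cs.mallows q) t =
        (∑ k ∈ Finset.range (d i), (Real.exp t * q) ^ k) / ∑ k ∈ Finset.range (d i), q ^ k)) ∧
    (q ≠ 1 →
      ∫ w, (cs.length w : ℝ) ∂(cs.mallows q) =
        (Fintype.card B : ℝ) * q / (1 - q) - ∑ i, (d i : ℝ) * q ^ d i / (1 - q ^ d i) ∧
      Var[fun w => (cs.length w : ℝ); cs.mallows q] =
        (Fintype.card B : ℝ) * q / (1 - q) ^ 2 -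
          ∑ i, (d i : ℝ) ^ 2 * q ^ d i / (1 - q ^ d i) ^ 2) := by
  have := CoxeterLength.neZero_of_isDegrees hd
  obtain ⟨e, he⟩ := CoxeterLength.exists_equiv_pi_fin_sum_eq_length hd
  have hmallows : cs.mallows q = CoxeterLength.gibbsMeasure q cs.length := rfl
  rw [hmallows]
  refine ⟨CoxeterLength.isProbabilityMeasure_gibbsMeasure hq _,
    ⟨fun i w => e w i, CoxeterLength.iIndepFun_gibbsMeasure_coordinate hq he,
      fun w => (he w).symm, CoxeterLength.mgf_gibbsMeasure_coordinate_fin hq he⟩,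
    fun hq1 => ⟨?_, ?_⟩⟩
  · rw [CoxeterLength.integral_energy_gibbsMeasure_fin hq hq1 he, Fintype.card_fin]
  · rw [CoxeterLength.variance_energy_gibbsMeasure_fin hq hq1 he, Fintype.card_fin]
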